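/- Let $p$ be a prime and let $F$ be an infinite field of characteristic $p$ (for example $F=\mathbb F_p(\xi_1,\xi_2,\dots)$). Let $M$ be a closed PL $5$-manifold with a fixed triangulation, i.e. a finite simplicial complex in which the link of every simplex is a PL sphere of the appropriate dimension; its vertices are natural numbers and simplices are written with increasing vertices. If $p\neq 2$, let $M$ be oriented. Let $\omega$ be a simplicial $3$-cocycle on $M$ with values in $F$ such that $\omega_{ijkl}\ne 0$ for every tetrahedron $ijkl$. *Colorings.* For a $4$-simplex $v$ of $M$, let $V_v$ be the space of $F$-valued simplicial $3$-cocycles on $v$ modulo multiples of $\omega|_v$. A coloring of $M$ (or of a simplicial complex with a parameter $\omega$ as above) assigns to every $4$-simplex $v$ an element of $V_v$. It is *permitted* if for every $5$-simplex $w$ there is a $3$-cocycle $\nu$ on $w$ (depending on $w$) whose class in $V_v$ is the color of $v$, for every $4$-face $v$ of $w$. A permitted coloring of $M$ is a *g-coloring* if it is given by a global $3$-cocycle on $M$ of the form $\delta\beta$, where $\beta$ is a simplicial $2$-cochain. *Cocycles.* A (parametric, $F$-valued) *heptagon $5$-cochain* $\mathfrak c$ assigns a value $\mathfrak c_w(r_1,r_2)\in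 F$ to every $5$-simplex $w$ (with vertices in $\mathbb N$), every nowhere vanishing $3$-cocycle $\omega$ on $w$, and every pair $(r_1,r_2)$ of permitted colorings of $w$. It is a *cocycle* if $\sum_{k=0}^{6}(-1)^k\,\mathfrak c_{i_0\dots\widehat{i_k}\dots i_6}(r_1,r_2)=0$ for every $6$-simplex $i_0\dots i_6$, every nowhere vanishing $3$-cocycle $\omega$ on it, and every pair of permitted colorings $r_1,r_2$ of it, all restricted to the faces. The *bipolynomial $5$-cocycle of degrees $p^k$* ($k$ a natural number) is defined as follows. For $3$-cocycles $\nu,\eta$ and a $4$-simplex $v$ put $Q_v(\nu,\eta)=(\delta\mu)(v)$, where $\mu_{ijkl}=\nu_{ijkl}\eta_{ijkl}/\omega_{ijkl}$. On a $5$-simplex $w$, take generic $3$-cocycles $\omega,\nu,\eta$ over $\mathbb Q$, whose linearly independent components are indeterminates; form the value on $w$ of the coboundary of the $4$-cochain $v\mapsto Q_v(\nu,\eta)^{p^k}$, divide it by $p$, and reduce the resulting rational function modulo $p$. Its value $\mathfrak c_w(r_1,r_2)$ is obtained by substituting the components of $\omega$ and of $3$-cocycles $\nu,\eta$ on $w$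 giving $r_1$ and $r_2$. **Proposition.** Let $\mathfrak c$ be the bipolynomial $5$-cocycle of degrees $p^k$ for some $k$, or, more generally, any $F$-valued parametric heptagon $5$-cocycle. For permitted colorings $\rho,\sigma$ of $M$ consider $$S(\rho,\sigma)=\sum_{w}\pm\,\mathfrak c_{w}(\rho|_w,\sigma|_w),$$ the sum over all $5$-simplices $w$ of $M$, where the sign is $+$ if the order of the vertices of $w$ agrees with the orientation of $M$ and $-$ otherwise (for $p=2$ the signs play no role). Then, for all permitted colorings $\rho,\sigma$ and all g-colorings $g,h$ of $M$, $$S(\rho+g,\sigma)=S(\rho,\sigma),\qquad S(\rho,\sigma+h)=S(\rho,\sigma),\qquad S(\rho+g,\sigma+h)=S(\rho,\sigma).$$ -/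

import Mathlib

noncomputable section

namespace Heptagon

/-! ### Simplicial complexes

A simplicial complex is Mathlib's `PreAbstractSimplicialComplex ℕ`: a set of nonempty finite sets
of natural numbers, closed under passing to nonempty subsets.  Vertices are natural numbers, and
simplices are oriented by the increasing order of their vertices. -/

/-- The `n`-simplices of a complex. -/
abbrev Simplices (K : PreAbstractSimplicialComplex ℕ) (n : ℕ) : Type :=
  {s : Finset ℕ // s ∈ K.faces ∧ s.card = n + 1}

/-- The simplex with vertex set `v`, with all its faces. -/
def simplex (v : Finset ℕ) : PreAbstractSimplicialComplex ℕ where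
  faces := {t | t.Nonempty ∧ t ⊆ v}
  isRelLowerSet_faces := fun _ ht => ⟨ht.1, fun _ hs hne => ⟨hne, hs.trans ht.2⟩⟩

/-- The boundary of the simplex with vertex set `v`: all its proper faces. -/
def simplexBoundary (v : Finset ℕ) : PreAbstractSimplicialComplex ℕ where
  faces := {t | t.Nonempty ∧ t ⊂ v}
  isRelLowerSet_faces := fun _ ht => ⟨ht.1, fun _ hs hne => ⟨hne, lt_of_le_of_lt hs ht.2⟩⟩

/-- The link of `s` in `K`. -/
def link (K : PreAbstractSimplicialComplex ℕ) (s : Finset ℕ) : PreAbstractSimplicialComplex ℕ where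
  faces := {t | t.Nonempty ∧ Disjoint t s ∧ t ∪ s ∈ K.faces}
  isRelLowerSet_faces := fun _ ht => ⟨ht.1, fun _ hs hne =>
    ⟨hne, Finset.disjoint_of_subset_left hs ht.2.1,
      K.isRelLowerSet_faces.mem_of_le ht.2.2 (Finset.union_subset_union_left hs)
        (hne.mono Finset.subset_union_left)⟩⟩

/-- The stellar subdivision of `K` at its simplex `A` with new vertex `a`: the open star of `A` is
removed and replaced by the join of `a`, the boundary of `A`, and the link of `A`.  (If `A` is a
vertex, this renames that vertex to `a`.) -/
def stellarSubdivision (K : PreAbstractSimplicialComplex ℕ) (A : Finset ℕ) (a : ℕ) :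
    PreAbstractSimplicialComplex ℕ where
  faces := {t | (t ∈ K.faces ∧ ¬ A ⊆ t) ∨
    (a ∈ t ∧ ¬ A ⊆ t.erase a ∧ t.erase a ∪ A ∈ K.faces)}
  isRelLowerSet_faces := by
    rintro t (⟨ht, hA⟩ | ⟨ha, hA, ht⟩)
    · exact ⟨(K.isRelLowerSet_faces ht).1, fun s hs hne =>
        Or.inl ⟨K.isRelLowerSet_faces.mem_of_le ht hs hne, fun h => hA (h.trans hs)⟩⟩
    · refine ⟨⟨a, ha⟩, fun s hs hne => ?_⟩
      have hs' : s.erase a ⊆ t.erase a := Finset.erase_subset_erase a hs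
      by_cases has : a ∈ s
      · refine Or.inr ⟨has, fun h => hA (h.trans hs'), ?_⟩
        refine K.isRelLowerSet_faces.mem_of_le ht (Finset.union_subset_union_left hs') ?_
        rcases A.eq_empty_or_nonempty with rfl | hne'
        · exact absurd (Finset.empty_subset _) hA
        · exact hne'.mono Finset.subset_union_right
      · have hst : s ⊆ t.erase a := by
          rw [← Finset.erase_eq_of_notMem has]; exact hs'
        exact Or.inl ⟨K.isRelLowerSet_faces.mem_of_le ht
          (hst.trans Finset.subset_union_left) hne, fun h => hA (h.trans hst)⟩

/-- PL equivalence of finite complexes, in its combinatorial form: `K` and `L` are joined by a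
finite sequence of stellar subdivisions (at simplices, with new vertices) and their inverses. -/
def StellarEquiv (K L : PreAbstractSimplicialComplex ℕ) : Prop :=
  Relation.EqvGen
    (fun K₁ K₂ => ∃ A ∈ K₁.faces, ∃ a : ℕ, {a} ∉ K₁.faces ∧ K₂ = stellarSubdivision K₁ A a) K L

/-- `K` is a (triangulated) closed PL manifold of dimension `n`: a finite complex of dimension at
most `n` in which the link of every `m`-simplex is a PL sphere of dimension `n - m - 1`, that is,
PL equivalent to the boundary of an `(n - m)`-simplex.  A PL sphere of dimension `-1` is the empty
complex.  Neither connectedness nor orientability is required. -/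
structure IsClosedPLManifold (n : ℕ) (K : PreAbstractSimplicialComplex ℕ) : Prop where
  finite : K.faces.Finite
  card_le : ∀ s ∈ K.faces, s.card ≤ n + 1
  link_sphere : ∀ s ∈ K.faces,
    StellarEquiv (link K s) (simplexBoundary (Finset.range (n + 2 - s.card)))

theorem simplex_le {K : PreAbstractSimplicialComplex ℕ} {v : Finset ℕ} (hv : v ∈ K.faces) :
    simplex v ≤ K :=
  fun _ ht => K.isRelLowerSet_faces.mem_of_le hv ht.2 ht.1

theorem simplex_mono {v w : Finset ℕ} (h : v ⊆ w) : simplex v ≤ simplex w :=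
  fun _ ht => ⟨ht.1, ht.2.trans h⟩

/-- The `n`-simplex `w` as a simplex of the complex formed by itself and its faces. -/
def self {n : ℕ} (w : Finset ℕ) (hw : w.card = n + 1) : Simplices (simplex w) n :=
  ⟨w, ⟨Finset.card_pos.mp (by omega), subset_rfl⟩, hw⟩

/-! ### Cochains -/

/-- The incidence sign of `s` and its face `s \ {i}`: `(-1)` to the number of the vertex `i`
in `s`, where vertices are ordered increasingly and numbered from `0`. -/
def sign (s : Finset ℕ) (i : ℕ) : ℤ := (-1) ^ (s.filter (· < i)).card

section Cochains

variable (K : PreAbstractSimplicialComplex ℕ) (n : ℕ) (R : Type*) [CommRing R]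

/-- Simplicial `n`-cochains. -/
abbrev Cochain : Type _ := Simplices K n → R

variable {K n} in
/-- The face of an `(n+1)`-simplex opposite to its vertex `i`. -/
def face (s : Simplices K (n + 1)) (i : s.1) : Simplices K n :=
  ⟨s.1.erase i, by
    have hc : (s.1.erase i).card = n + 1 := by
      rw [Finset.card_erase_of_mem i.2, s.2.2]; rfl
    exact ⟨K.isRelLowerSet_faces.mem_of_le s.2.1 (Finset.erase_subset _ _)
      (Finset.card_pos.mp (by omega)), hc⟩⟩

/-- The simplicial coboundary. -/
def coboundary : Cochain K n R →ₗ[R] Cochain K (n + 1) R where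
  toFun f s := ∑ i : s.1, (sign s.1 i : R) * f (face s i)
  map_add' f g := by
    funext s
    simp only [Pi.add_apply, mul_add, Finset.sum_add_distrib]
  map_smul' a f := by
    funext s
    simp only [Pi.smul_apply, smul_eq_mul, RingHom.id_apply, Finset.mul_sum]
    exact Finset.sum_congr rfl fun i _ => by ring

/-- Simplicial `n`-cocycles. -/
abbrev Cocycles : Submodule R (Cochain K n R) := LinearMap.ker (coboundary K n R)

variable {K} in
/-- Restriction of cocycles to a subcomplex. -/
def restrict {L : PreAbstractSimplicialComplex ℕ} (h : L ≤ K) :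
    Cocycles K n R →ₗ[R] Cocycles L n R where
  toFun f := ⟨fun t => f.1 ⟨t.1, h t.2.1, t.2.2⟩, by
    have hf := LinearMap.mem_ker.mp f.2
    refine LinearMap.mem_ker.mpr (funext fun s => ?_)
    exact congrFun hf ⟨s.1, h s.2.1, s.2.2⟩⟩
  map_add' _ _ := rfl
  map_smul' _ _ := rfl

end Cochains

/-! ### Permitted colorings -/

section Colorings

variable {F : Type*} [Field F]

/-- The parameters: simplicial 3-cocycles `ω` none of whose components vanishes. -/
def Param (K : PreAbstractSimplicialComplex ℕ) (F : Type*) [Field F] : Type _ :=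
  {ω : Cocycles K 3 F // ∀ t, ω.1 t ≠ 0}

/-- Restriction of the parameter to a subcomplex. -/
def Param.restrict {K L : PreAbstractSimplicialComplex ℕ} (ω : Param K F) (h : L ≤ K) :
    Param L F :=
  ⟨Heptagon.restrict 3 F h ω.1, fun t => ω.2 ⟨t.1, h t.2.1, t.2.2⟩⟩

/-- The color space of a 4-simplex `v` (with the parameter `ω`): 3-cocycles on `v` modulo
multiples of `ω`. -/
abbrev ColorSpace {v : Finset ℕ} (ω : Param (simplex v) F) : Type _ :=
  Cocycles (simplex v) 3 F ⧸ Submodule.span F {ω.1}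

variable {K L : PreAbstractSimplicialComplex ℕ}

/-- Colorings of all 4-simplices of `K`, permitted or not. -/
abbrev Coloring (ω : Param K F) : Type _ :=
  (v : Simplices K 4) → ColorSpace (ω.restrict (simplex_le v.2.1))

/-- Restriction of a coloring to a subcomplex. -/
def Coloring.restrict {ω : Param K F} (r : Coloring ω) (h : L ≤ K) : Coloring (ω.restrict h) :=
  fun v => r ⟨v.1, h v.2.1, v.2.2⟩

/-- The coloring of the 4-simplices of `K` given by a global 3-cocycle `ν` modulo `ω`. -/
def coloringOf (ω : Param K F) : Cocycles K 3 F →ₗ[F] Coloring ω :=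
  LinearMap.pi fun v =>
    (Submodule.mkQ (Submodule.span F {(ω.restrict (simplex_le v.2.1)).1})).comp
      (restrict 3 F (simplex_le v.2.1))

/-- Permitted colorings of `K`: on each 5-simplex `w` of `K`, the coloring is given by a 3-cocycle
`ν` on `w` (which may depend on `w`). -/
def Permitted (ω : Param K F) : Submodule F (Coloring ω) where
  carrier := {r | ∀ w : Simplices K 5, ∃ ν : Cocycles (simplex w.1) 3 F,
    r.restrict (simplex_le w.2.1) = coloringOf (ω.restrict (simplex_le w.2.1)) ν}
  zero_mem' := fun _ => ⟨0, by rw [map_zero]; rfl⟩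
  add_mem' := fun {r r'} hr hr' w => by
    obtain ⟨ν, hν⟩ := hr w
    obtain ⟨ν', hν'⟩ := hr' w
    refine ⟨ν + ν', ?_⟩
    rw [map_add, ← hν, ← hν']; rfl
  smul_mem' := fun a r hr w => by
    obtain ⟨ν, hν⟩ := hr w
    refine ⟨a • ν, ?_⟩
    rw [map_smul, ← hν]; rfl

/-- Restriction of a permitted coloring to a subcomplex. -/
def restrictPermitted {ω : Param K F} (r : Permitted ω) (h : L ≤ K) :
    Permitted (ω.restrict h) :=
  ⟨r.1.restrict h, fun w => r.2 ⟨w.1, h w.2.1, w.2.2⟩⟩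

/-- g-colorings: the permitted colorings given by global 3-cocycles that are coboundaries `δβ` of
2-cochains `β`. -/
def gColorings (ω : Param K F) : Submodule F (Permitted ω) :=
  (((LinearMap.range (coboundary K 2 F)).comap (Cocycles K 3 F).subtype).map
    (coloringOf ω)).comap (Permitted ω).subtype

end Colorings

/-! ### Heptagon 5-cochains -/

/-- A parametric heptagon 5-cochain on double colorings, with values in `F`: a function of a
5-simplex `w` with its parameter `ω` and a pair of permitted colorings of `w`. -/
def FiveCochain (F : Type*) [Field F] : Type _ :=
  (w : Finset ℕ) → w.card = 6 → (ω : Param (simplex w) F) → Permitted ω → Permitted ω → F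

/-- `c` is a parametric heptagon 5-cocycle: its coboundary vanishes on every 6-simplex `u`, for each
parameter `ω` on `u` and each pair of permitted colorings of `u`. -/
def FiveCochain.IsCocycle {F : Type*} [Field F] (c : FiveCochain F) : Prop :=
  ∀ (u : Finset ℕ) (hu : u.card = 7) (ω : Param (simplex u) F) (r₁ r₂ : Permitted ω),
    ∑ i : u, (sign u i : F) *
      c (u.erase i) (by rw [Finset.card_erase_of_mem i.2, hu])
        (ω.restrict (simplex_mono (Finset.erase_subset _ _)))
        (restrictPermitted r₁ (simplex_mono (Finset.erase_subset _ _)))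
        (restrictPermitted r₂ (simplex_mono (Finset.erase_subset _ _))) = 0

/-! ### The bilinear 4-cocycle and the bipolynomial 5-cocycles -/

/-- The bilinear 4-cochain `Q(ν, η)`: the coboundary of `μ = ν η / ω`. -/
def bilinearQ (K : PreAbstractSimplicialComplex ℕ) {E : Type*} [Field E] (ω ν η : Cochain K 3 E) :
    Cochain K 4 E :=
  coboundary K 3 E fun t => ν t * η t / ω t

/-- The tetrahedra of the simplex `w` that contain its first vertex.  The components of 3-cocycles
on these tetrahedra are a maximal set of linearly independent components. -/
def FreeTet (w : Finset ℕ) : Type :=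
  {t : Simplices (simplex w) 3 // ∃ a ∈ t.1, ∀ b ∈ w, a ≤ b}

/-- The tetrahedron spanned by the first vertex of `w` and the face of `t` opposite to `i`, where
`t` is a tetrahedron of `w` not containing this first vertex. -/
def coneTet {w : Finset ℕ} (t : Simplices (simplex w) 3) (h : ¬ ∃ a ∈ t.1, ∀ b ∈ w, a ≤ b)
    (i : t.1) : FreeTet w :=
  have hw : w.Nonempty := t.2.1.1.mono t.2.1.2
  ⟨⟨insert (w.min' hw) (t.1.erase i),
      ⟨Finset.insert_nonempty _ _, Finset.insert_subset (w.min'_mem hw)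
        ((Finset.erase_subset _ _).trans t.2.1.2)⟩, by
      have hn : w.min' hw ∉ t.1.erase i := fun hm =>
        h ⟨_, Finset.mem_of_mem_erase hm, fun b hb => w.min'_le b hb⟩
      rw [Finset.card_insert_of_notMem hn, Finset.card_erase_of_mem i.2, t.2.2]⟩,
    ⟨w.min' hw, Finset.mem_insert_self _ _, fun b hb => w.min'_le b hb⟩⟩

open Classical in
/-- The 3-cocycle on the simplex `w` with the given components on the tetrahedra containing the
first vertex; the other components are expressed through these. -/
def cocycleOfFree (w : Finset ℕ) {E : Type*} [CommRing E] (x : FreeTet w → E) :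
    Cochain (simplex w) 3 E :=
  fun t => if h : ∃ a ∈ t.1, ∀ b ∈ w, a ≤ b then x ⟨t, h⟩
    else ∑ i : t.1, (sign t.1 i : E) * x (coneTet t h i)

/-- The indeterminates: the independent components of `ω` (index `0`), `ν` (index `1`) and
`η` (index `2`) on the simplex `w`. -/
abbrev Var (w : Finset ℕ) : Type := Fin 3 × FreeTet w

/-- The field of rational functions over `ℚ` in the indeterminates, as the field of fractions of
the polynomial ring over `ℤ`. -/
abbrev GenericField (w : Finset ℕ) : Type := FractionRing (MvPolynomial (Var w) ℤ)

/-- The generic 3-cocycles `ω`, `ν`, `η` on `w`, whose independent components are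
indeterminates. -/
def genericCocycle (w : Finset ℕ) (j : Fin 3) : Cochain (simplex w) 3 (GenericField w) :=
  cocycleOfFree w fun t => algebraMap (MvPolynomial (Var w) ℤ) (GenericField w)
    (MvPolynomial.X (j, t))

/-- In characteristic zero, on the 5-simplex `w`: the coboundary of the `p^k`-th powers of the
values of `Q`, divided by `p`. -/
def genericValue (p k : ℕ) (w : Finset ℕ) (hw : w.card = 6) : GenericField w :=
  coboundary (simplex w) 4 (GenericField w)
    (fun v => bilinearQ (simplex w) (genericCocycle w 0) (genericCocycle w 1)
      (genericCocycle w 2) v ^ p ^ k) (self w hw) / (p : GenericField w)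

section Reduction

variable (p : ℕ) [Fact p.Prime] {ι : Type}

open Classical in
/-- Reduction modulo `p` of a rational function: if `f = P / D` with integer polynomials `P`, `D`
and `D` is nonzero modulo `p`, reduce the coefficients of `P` and `D` modulo `p`.  (The value is `0`
by convention if `f` has no such representation.) -/
def reduceMod (f : FractionRing (MvPolynomial ι ℤ)) : FractionRing (MvPolynomial ι (ZMod p)) :=
  if h : ∃ PD : MvPolynomial ι ℤ × MvPolynomial ι ℤ,
      MvPolynomial.map (Int.castRingHom (ZMod p)) PD.2 ≠ 0 ∧
        f = algebraMap _ (FractionRing (MvPolynomial ι ℤ)) PD.1 / algebraMap _ _ PD.2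
  then algebraMap _ (FractionRing (MvPolynomial ι (ZMod p)))
      (MvPolynomial.map (Int.castRingHom (ZMod p)) h.choose.1) /
    algebraMap _ _ (MvPolynomial.map (Int.castRingHom (ZMod p)) h.choose.2)
  else 0

/-- Reduction modulo `p` does not depend on the representation. -/
theorem reduceMod_eq (P D : MvPolynomial ι ℤ)
    (hD : MvPolynomial.map (Int.castRingHom (ZMod p)) D ≠ 0) :
    reduceMod p (algebraMap _ (FractionRing (MvPolynomial ι ℤ)) P / algebraMap _ _ D) =
      algebraMap _ (FractionRing (MvPolynomial ι (ZMod p)))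
          (MvPolynomial.map (Int.castRingHom (ZMod p)) P) /
        algebraMap _ _ (MvPolynomial.map (Int.castRingHom (ZMod p)) D) := by
  have key : ∃ PD : MvPolynomial ι ℤ × MvPolynomial ι ℤ,
      MvPolynomial.map (Int.castRingHom (ZMod p)) PD.2 ≠ 0 ∧
        algebraMap _ (FractionRing (MvPolynomial ι ℤ)) P / algebraMap _ _ D =
          algebraMap _ (FractionRing (MvPolynomial ι ℤ)) PD.1 / algebraMap _ _ PD.2 :=
    ⟨(P, D), hD, rfl⟩
  unfold reduceMod
  rw [dif_pos key]
  obtain ⟨h1, h2⟩ := key.choose_spec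
  have nz : ∀ {A : MvPolynomial ι ℤ}, MvPolynomial.map (Int.castRingHom (ZMod p)) A ≠ 0 →
      algebraMap _ (FractionRing (MvPolynomial ι ℤ)) A ≠ 0 := fun hA h0 => hA (by
    rw [(IsFractionRing.to_map_eq_zero_iff (K := FractionRing (MvPolynomial ι ℤ))).mp h0, map_zero])
  have nz' : ∀ {A : MvPolynomial ι (ZMod p)}, A ≠ 0 →
      algebraMap _ (FractionRing (MvPolynomial ι (ZMod p))) A ≠ 0 := fun hA h0 =>
    hA ((IsFractionRing.to_map_eq_zero_iff (K := FractionRing (MvPolynomial ι (ZMod p)))).mp h0)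
  rw [div_eq_div_iff (nz hD) (nz h1), ← map_mul, ← map_mul] at h2
  have h3 := IsFractionRing.injective (MvPolynomial ι ℤ) (FractionRing (MvPolynomial ι ℤ)) h2
  rw [div_eq_div_iff (nz' h1) (nz' hD), ← map_mul, ← map_mul, ← map_mul, ← map_mul, h3]

variable {p}
variable {F : Type*} [Field F] [CharP F p]

/-- The value of a polynomial over `𝔽_p` at a point with coordinates in a field `F` of
characteristic `p`. -/
def polyEval (p : ℕ) {ι : Type} {F : Type*} [Field F] [CharP F p] (x : ι → F) :
    MvPolynomial ι (ZMod p) →+* F :=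
  MvPolynomial.eval₂Hom (ZMod.castHom (dvd_refl p) F) x

open Classical in
/-- The value of a rational function over `𝔽_p` at a point with coordinates in a field `F` of
characteristic `p`.  (The value is `0` by convention where the function is not defined.) -/
def evalAt (f : FractionRing (MvPolynomial ι (ZMod p))) (x : ι → F) : F :=
  if h : ∃ PD : MvPolynomial ι (ZMod p) × MvPolynomial ι (ZMod p),
      polyEval p x PD.2 ≠ 0 ∧
        f = algebraMap _ (FractionRing (MvPolynomial ι (ZMod p))) PD.1 / algebraMap _ _ PD.2
  then polyEval p x h.choose.1 / polyEval p x h.choose.2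
  else 0

/-- The value of a rational function does not depend on the representation. -/
theorem evalAt_eq (P D : MvPolynomial ι (ZMod p)) (x : ι → F) (hD : polyEval p x D ≠ 0) :
    evalAt (algebraMap _ (FractionRing (MvPolynomial ι (ZMod p))) P / algebraMap _ _ D) x =
      polyEval p x P / polyEval p x D := by
  have key : ∃ PD : MvPolynomial ι (ZMod p) × MvPolynomial ι (ZMod p),
      polyEval p x PD.2 ≠ 0 ∧
        algebraMap _ (FractionRing (MvPolynomial ι (ZMod p))) P / algebraMap _ _ D =
          algebraMap _ (FractionRing (MvPolynomial ι (ZMod p))) PD.1 / algebraMap _ _ PD.2 :=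
    ⟨(P, D), hD, rfl⟩
  unfold evalAt
  rw [dif_pos key]
  obtain ⟨h1, h2⟩ := key.choose_spec
  have nz : ∀ {A : MvPolynomial ι (ZMod p)}, polyEval p x A ≠ 0 →
      algebraMap _ (FractionRing (MvPolynomial ι (ZMod p))) A ≠ 0 := fun hA h0 => hA (by
    rw [(IsFractionRing.to_map_eq_zero_iff
      (K := FractionRing (MvPolynomial ι (ZMod p)))).mp h0, map_zero])
  rw [div_eq_div_iff (nz hD) (nz h1), ← map_mul, ← map_mul] at h2
  have h3 := IsFractionRing.injective (MvPolynomial ι (ZMod p))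
    (FractionRing (MvPolynomial ι (ZMod p))) h2
  rw [div_eq_div_iff h1 hD, ← map_mul, ← map_mul, h3]

end Reduction

section Bipolynomial

variable {F : Type*} [Field F]

/-- A 3-cocycle on the 5-simplex `w` that gives the permitted coloring `r` of `w`. -/
def representative {w : Finset ℕ} (hw : w.card = 6) {ω : Param (simplex w) F} (r : Permitted ω) :
    Cocycles (simplex w) 3 F :=
  (r.2 (self w hw)).choose

/-- The bipolynomial 5-cocycle of degrees `p^k`: the generic value in characteristic zero, reduced
modulo `p`, at the components of `ω` and of 3-cocycles `ν`, `η` giving the two colorings. -/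
def bipolynomialCocycle (p : ℕ) [Fact p.Prime] (k : ℕ) (F : Type*) [Field F] [CharP F p] :
    FiveCochain F :=
  fun w hw ω r₁ r₂ => evalAt (reduceMod p (genericValue p k w hw)) fun jt : Var w =>
    (![ω.1, representative hw r₁, representative hw r₂] jt.1).1 jt.2.1

end Bipolynomial

/-! ### The sum over the 5-simplices of a triangulated manifold -/

/-- The incidence number of the simplices `w` and `v` (`0` if `v` is not a facet of `w`). -/
def incidence (w v : Finset ℕ) : ℤ := ∑ i ∈ w, if w.erase i = v then sign w i else 0

/-- `o` chooses orientations of the 5-simplices of `K` (`1` for the orientation by increasing order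
of the vertices) so that their sum is a cycle: `o` is an orientation of the manifold `K`. -/
def IsOrientation {K : PreAbstractSimplicialComplex ℕ} (o : Simplices K 5 → ℤˣ) : Prop :=
  ∀ v : Simplices K 4, ∑ᶠ w : Simplices K 5, (o w : ℤ) * incidence w.1 v.1 = 0

/-- The sum of the values of the 5-cochain `c` on the restrictions of `(ρ, σ)` to all 5-simplices
of `K`, oriented by `o`. -/
def cochainSum {F : Type*} [Field F] {K : PreAbstractSimplicialComplex ℕ} (o : Simplices K 5 → ℤˣ)
    (c : FiveCochain F) {ω : Param K F} (ρ σ : Permitted ω) : F :=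
  ∑ᶠ w : Simplices K 5, ((o w : ℤ) : F) *
    c w.1 w.2.2 (ω.restrict (simplex_le w.2.1)) (restrictPermitted ρ (simplex_le w.2.1))
      (restrictPermitted σ (simplex_le w.2.1))

end Heptagon

end

noncomputable section

namespace Heptagon

/-! ### The total differential on functions of finite sets -/

section Differential

variable {R : Type*} [CommRing R]

/-! Invariance. A 5-cocycle keeps its form when the two colorings are interchanged, so it suffices
to change the first one; by additivity of `δ` it suffices to take `β` supported on a single triangle
`s`. Only the 5-simplices containing `s` are affected. On the union of these, the permitted coloring
comes from one 3-cocycle (`exists_cocycle_on_star`). The local representatives on neighbouring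
5-simplices differ by multiples of `ω`, and the coefficients of these multiples form a 1-cycle in
the link of `s`. The link is a 2-sphere, so the cycle is a boundary and the representatives can be
corrected by multiples of `ω` to agree along 4-simplices; connectedness of the links of tetrahedra
(circles) then makes them agree everywhere.

Next, cone the star of `s` from a new vertex `x`. The star is itself a cone, so its cocycles are
coboundaries and extend. The parameter extends without zeros because `F` is infinite and only
finitely many values must be avoided (`exists_param_extension`). Let `f` be the difference of the
values of the 5-cocycle after and before adding `δβ`. It is a simplicial 5-cocycle on the cone and
vanishes on simplices that do not contain `s`. The equation `δf = 0` on `x * w` expresses `f(w)`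
through the values `f(x * v)` for the facets `v ⊇ s` of `w`. In the sum over `w` each `f(x * v)`
gets the coefficient of `v` in the boundary of the fundamental cycle, which is zero
(`cochainSum_add_coboundary_single`).

The bipolynomial cochain. By Frobenius, `δ(V^(p^k)) - (δV)^(p^k)` is `p` times an integer polynomial
in the values of `V`. For `V = δU` this polynomial is a cocycle: over `ℤ[U]` its coboundary is
killed by `p`, hence zero, and the identity specializes to any ring. In characteristic `p` the
bipolynomial cochain is this polynomial in the values of `Q` (`bipolynomialCocycle_eq`), and on a
6-simplex `Q` is a cocycle, hence some `δU`.

The topology of `M` enters through three facts about links, each checked to be invariant under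
stellar moves: a 0-sphere is two points, a circle is connected, and a 2-sphere has no first
cohomology. -/

theorem sign_mul_self (s : Finset ℕ) (i : ℕ) : sign s i * sign s i = 1 := by
  rw [sign, ← pow_add, ← two_mul, pow_mul]; norm_num

theorem sign_eq_one_or (s : Finset ℕ) (i : ℕ) : sign s i = 1 ∨ sign s i = -1 :=
  neg_one_pow_eq_or ℤ _

theorem sign_erase {s : Finset ℕ} {i : ℕ} (hi : i ∈ s) (j : ℕ) :
    sign s j = (if i < j then -1 else 1) * sign (s.erase i) j := by
  unfold sign
  rw [Finset.filter_erase]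
  split_ifs with h
  · have hm : i ∈ s.filter (· < j) := Finset.mem_filter.mpr ⟨hi, h⟩
    rw [← Finset.card_erase_add_one hm, pow_succ]; ring
  · rw [Finset.erase_eq_of_notMem (a := i) fun hm => h (Finset.mem_filter.mp hm).2, one_mul]

/-- Exactly one of the two vertices precedes the other, so exactly one of the two signs changes
after the erasure. -/
theorem sign_swap {s : Finset ℕ} {i j : ℕ} (hi : i ∈ s) (hj : j ∈ s) (hij : i ≠ j) :
    sign s i * sign (s.erase i) j = -(sign s j * sign (s.erase j) i) := by
  rw [sign_erase hj i, sign_erase hi j]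
  rcases lt_or_gt_of_ne hij with h | h
  · rw [if_neg h.not_gt, if_pos h]; ring
  · rw [if_neg h.not_gt, if_pos h]; ring

/-- The coboundary of a function of finite sets of vertices. -/
def diff (f : Finset ℕ → R) (s : Finset ℕ) : R := ∑ i ∈ s, (sign s i : R) * f (s.erase i)

theorem diff_diff (f : Finset ℕ → R) : diff (diff f) = 0 := by
  funext s
  simp only [diff, Finset.mul_sum, Pi.zero_apply]
  rw [Finset.sum_sigma']
  -- The terms `(i, j)` and `(j, i)` belong to the same face and have opposite signs.
  refine Finset.sum_involution (fun x _ => ⟨x.2, x.1⟩) ?_ ?_ ?_ ?_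
  · rintro ⟨i, j⟩ h
    simp only [Finset.mem_sigma, Finset.mem_erase] at h
    obtain ⟨hi, hne, hj⟩ := h
    have := sign_swap hi hj (Ne.symm hne)
    rw [Finset.erase_right_comm (a := j)]
    rw [← mul_assoc, ← mul_assoc, ← add_mul, ← Int.cast_mul, ← Int.cast_mul, this]
    simp
  · rintro ⟨i, j⟩ h _ heq
    simp only [Finset.mem_sigma, Finset.mem_erase] at h
    exact h.2.1 (congrArg Sigma.fst heq)
  · rintro ⟨i, j⟩ h
    simp only [Finset.mem_sigma, Finset.mem_erase] at h ⊢
    exact ⟨h.2.2, Ne.symm h.2.1, h.1⟩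
  · rintro ⟨i, j⟩ h
    rfl

theorem diff_congr {f g : Finset ℕ → R} {s : Finset ℕ}
    (h : ∀ i ∈ s, f (s.erase i) = g (s.erase i)) : diff f s = diff g s :=
  Finset.sum_congr rfl fun i hi => by rw [h i hi]

/-- The contracting homotopy of a cone with apex `a`. -/
def coneHomotopy (a : ℕ) (f : Finset ℕ → R) (t : Finset ℕ) : R :=
  if a ∈ t then 0 else (sign (insert a t) a : R) * f (insert a t)

/-- If `a ∈ s`, only the face opposite `a` survives, and the second summand is zero by definition.
If `a ∉ s`, the faces of `insert a s` through `a` cancel the first summand by `sign_swap`, and the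
face opposite `a` gives `f s`. -/
theorem diff_coneHomotopy (a : ℕ) (f : Finset ℕ → R) (s : Finset ℕ) :
    diff (coneHomotopy a f) s + coneHomotopy a (diff f) s = f s := by
  have hsq : ∀ t : Finset ℕ, (sign t a : R) * (sign t a : R) = 1 := fun t => by
    rw [← Int.cast_mul, sign_mul_self, Int.cast_one]
  by_cases ha : a ∈ s
  · rw [coneHomotopy, if_pos ha, add_zero, diff, Finset.sum_eq_single_of_mem a ha]
    · rw [coneHomotopy, if_neg (Finset.notMem_erase a s), Finset.insert_erase ha, ← mul_assoc,
        hsq, one_mul]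
    · intro i _ hia
      rw [coneHomotopy, if_pos (Finset.mem_erase.mpr ⟨Ne.symm hia, ha⟩), mul_zero]
  · rw [coneHomotopy, if_neg ha, diff, diff, Finset.sum_insert ha, Finset.erase_insert ha, mul_add,
      ← mul_assoc, hsq, one_mul, add_left_comm, add_eq_left, Finset.mul_sum,
      ← Finset.sum_add_distrib]
    refine Finset.sum_eq_zero fun i hi => ?_
    have hia : i ≠ a := fun h => ha (h ▸ hi)
    rw [coneHomotopy, if_neg fun h => ha (Finset.mem_of_mem_erase h),
      ← Finset.erase_insert_of_ne (Ne.symm hia), ← mul_assoc, ← mul_assoc, ← add_mul]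
    have h1 := sign_swap (Finset.mem_insert_of_mem hi) (Finset.mem_insert_self a s) hia
    rw [Finset.erase_insert ha] at h1
    have h2 := sign_mul_self (insert a s) a
    have h3 := sign_mul_self s i
    have h4 := sign_mul_self (insert a s) i
    have h5 := sign_mul_self ((insert a s).erase i) a
    have : sign s i * sign ((insert a s).erase i) a
        + sign (insert a s) a * sign (insert a s) i = 0 := by
      linear_combination (sign s i * sign (insert a s) i) * h1
        - (sign s i * sign ((insert a s).erase i) a) * h4
        - (sign (insert a s) a * sign (insert a s) i) * h3
    rw [← Int.cast_mul, ← Int.cast_mul, ← Int.cast_add, this, Int.cast_zero, zero_mul]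

variable {K L : PreAbstractSimplicialComplex ℕ} {n : ℕ}

theorem coboundary_eq_diff (f : Cochain K n R) (g : Finset ℕ → R) (h : ∀ t, f t = g t.1)
    (s : Simplices K (n + 1)) : coboundary K n R f s = diff g s.1 := by
  change ∑ i : s.1, (sign s.1 i : R) * f (face s i) = _
  rw [diff, ← Finset.sum_coe_sort s.1 fun i => (sign s.1 i : R) * g (s.1.erase i)]
  exact Finset.sum_congr rfl fun i _ => by rw [h]; rfl

open Classical in
/-- The extension of a cochain by zero to all finite sets of vertices. -/
def zeroExt (f : Cochain K n R) (t : Finset ℕ) : R :=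
  if h : t ∈ K.faces ∧ t.card = n + 1 then f ⟨t, h⟩ else 0

theorem zeroExt_apply (f : Cochain K n R) (t : Simplices K n) : zeroExt f t.1 = f t :=
  dif_pos t.2

theorem coboundary_eq_diff_zeroExt (f : Cochain K n R) (s : Simplices K (n + 1)) :
    coboundary K n R f s = diff (zeroExt f) s.1 :=
  coboundary_eq_diff f _ (fun t => (zeroExt_apply f t).symm) s

theorem coboundary_coboundary (f : Cochain K n R) :
    coboundary K (n + 1) R (coboundary K n R f) = 0 := by
  funext s
  rw [coboundary_eq_diff _ (diff (zeroExt f)) (coboundary_eq_diff_zeroExt f), diff_diff]; rfl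

theorem diff_zeroExt_of_mem_cocycles (f : Cocycles K n R) (s : Simplices K (n + 1)) :
    diff (zeroExt f.1) s.1 = 0 := by
  rw [← coboundary_eq_diff_zeroExt]
  exact congrFun (LinearMap.mem_ker.mp f.2) s

/-- Cocycles of positive degree on a cone are coboundaries. -/
theorem exists_coboundary_eq {a : ℕ} (hK : ∀ t ∈ K.faces, insert a t ∈ K.faces)
    (f : Cocycles K (n + 1) R) : ∃ γ : Cochain K n R, coboundary K n R γ = f.1 := by
  refine ⟨fun t => coneHomotopy a (zeroExt f.1) t.1, funext fun s => ?_⟩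
  rw [coboundary_eq_diff _ _ (fun _ => rfl), ← zeroExt_apply f.1 s,
    ← diff_coneHomotopy a (zeroExt f.1) s.1, left_eq_add, coneHomotopy]
  split_ifs with ha
  · rfl
  · rw [diff_zeroExt_of_mem_cocycles f ⟨insert a s.1, hK _ s.2.1, by
      rw [Finset.card_insert_of_notMem ha, s.2.2]⟩, mul_zero]

end Differential

/-! ### Divided differences of powers -/

section PowerPolynomial

variable {R S : Type*} [CommRing R] [CommRing S]

theorem map_diff (φ : R →+* S) (f : Finset ℕ → R) (s : Finset ℕ) :
    φ (diff f s) = diff (fun t => φ (f t)) s := by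
  simp only [diff, map_sum, map_mul, map_intCast]

/-- Modulo `p` the `p^k`-th power is additive and fixes the signs, which lie in the prime field, so
the right-hand side has all coefficients divisible by `p`. -/
theorem exists_powerPolynomial (p : ℕ) [Fact p.Prime] (k : ℕ) (w : Finset ℕ) :
    ∃ Φ : MvPolynomial w ℤ, (p : MvPolynomial w ℤ) * Φ =
      (∑ i : w, (sign w i : MvPolynomial w ℤ) * MvPolynomial.X i ^ p ^ k) -
        (∑ i : w, (sign w i : MvPolynomial w ℤ) * MvPolynomial.X i) ^ p ^ k := by
  have h : (MvPolynomial.C (p : ℤ)) ∣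
      (∑ i : w, (sign w i : MvPolynomial w ℤ) * MvPolynomial.X i ^ p ^ k) -
        (∑ i : w, (sign w i : MvPolynomial w ℤ) * MvPolynomial.X i) ^ p ^ k := by
    rw [MvPolynomial.C_dvd_iff_map_hom_eq_zero (Int.castRingHom (ZMod p)) (p : ℤ)
      (fun c => by rw [Int.coe_castRingHom, ZMod.intCast_zmod_eq_zero_iff_dvd c p])]
    simp only [map_sub, map_sum, map_mul, map_pow, map_intCast, MvPolynomial.map_X]
    rw [sum_pow_char_pow, sub_eq_zero]
    refine Finset.sum_congr rfl fun i _ => ?_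
    rw [mul_pow, ← map_intCast (MvPolynomial.C (σ := w) (R := ZMod p)), ← map_pow,
      ZMod.pow_card_pow]
  obtain ⟨Φ, hΦ⟩ := h
  exact ⟨Φ, by rw [hΦ]; simp⟩

/-- The integer polynomial that expresses the coboundary of a `p^k`-th power, minus the `p^k`-th
power of the coboundary, divided by `p`, through the values on the faces. -/
def powerPolynomial (p : ℕ) [Fact p.Prime] (k : ℕ) (w : Finset ℕ) : MvPolynomial w ℤ :=
  (exists_powerPolynomial p k w).choose

/-- The value of `powerPolynomial` at the values of `V` on the faces of `w`. -/
def powerValue (p : ℕ) [Fact p.Prime] (k : ℕ) (V : Finset ℕ → R) (w : Finset ℕ) : R :=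
  MvPolynomial.aeval (fun i : w => V (w.erase i)) (powerPolynomial p k w)

variable (p : ℕ) [Fact p.Prime] (k : ℕ)

theorem mul_powerValue (V : Finset ℕ → R) (w : Finset ℕ) :
    (p : R) * powerValue p k V w = diff (fun v => V v ^ p ^ k) w - diff V w ^ p ^ k := by
  have h := congrArg (MvPolynomial.aeval fun i : w => V (w.erase i))
    (exists_powerPolynomial p k w).choose_spec
  simp only [map_sub, map_sum, map_mul, map_pow, map_intCast, map_natCast,
    MvPolynomial.aeval_X] at h
  rw [powerValue, powerPolynomial, h, diff, diff,
    ← Finset.sum_coe_sort w fun i => (sign w i : R) * V (w.erase i) ^ p ^ k,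
    ← Finset.sum_coe_sort w fun i => (sign w i : R) * V (w.erase i)]

theorem powerValue_congr {V V' : Finset ℕ → R} {w : Finset ℕ}
    (h : ∀ i ∈ w, V (w.erase i) = V' (w.erase i)) : powerValue p k V w = powerValue p k V' w := by
  rw [powerValue, powerValue, funext fun i : w => h i.1 i.2]

/-- The coefficients are integers, so ring homomorphisms preserve them. -/
theorem map_powerValue (φ : R →+* S) (V : Finset ℕ → R) (w : Finset ℕ) :
    φ (powerValue p k V w) = powerValue p k (fun v => φ (V v)) w :=
  MvPolynomial.comp_aeval_apply _ φ.toIntAlgHom _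

/-- Universal argument: in the polynomial ring over `ℤ` on one variable per finite set, `p` can be
cancelled, and `p` times the left-hand side is a coboundary of a coboundary. Substituting `U` for
the variables gives the identity in `R`, even where `p = 0`. -/
theorem diff_powerValue_diff (U : Finset ℕ → R) : diff (powerValue p k (diff U)) = 0 := by
  funext u
  have key : diff (powerValue p k (diff (MvPolynomial.X : Finset ℕ → MvPolynomial (Finset ℕ) ℤ))) u
      = 0 := by
    have hp : (p : MvPolynomial (Finset ℕ) ℤ) ≠ 0 :=
      Nat.cast_ne_zero.mpr (Fact.out : p.Prime).ne_zero
    refine (mul_eq_zero.mp ?_).resolve_left hp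
    have h : (p : MvPolynomial (Finset ℕ) ℤ) * diff (powerValue p k (diff MvPolynomial.X)) u =
        diff (fun w => (p : MvPolynomial (Finset ℕ) ℤ) *
          powerValue p k (diff MvPolynomial.X) w) u := by
      simp only [diff, Finset.mul_sum]
      exact Finset.sum_congr rfl fun i _ => by ring
    have h' : (fun w => (p : MvPolynomial (Finset ℕ) ℤ) *
        powerValue p k (diff MvPolynomial.X) w) =
          diff fun v => diff MvPolynomial.X v ^ p ^ k := by
      funext w
      rw [mul_powerValue, diff_diff, Pi.zero_apply,
        zero_pow (pow_ne_zero k (Fact.out : p.Prime).ne_zero), sub_zero]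
    rw [h, h', diff_diff, Pi.zero_apply]
  have h := congrArg (MvPolynomial.aeval (R := ℤ) U).toRingHom key
  rw [map_diff, map_zero] at h
  rw [Pi.zero_apply, ← h]
  refine diff_congr fun i _ => ?_
  rw [map_powerValue]
  refine powerValue_congr p k fun j _ => ?_
  rw [map_diff]
  simp

end PowerPolynomial

/-! ### Specialization of rational functions -/

section Specialization

variable (p : ℕ) {ι : Type} {F : Type*} [Field F] [CharP F p]

/-- Reduction modulo `p` followed by evaluation, on integer polynomials. -/
def specialize (x : ι → F) : MvPolynomial ι ℤ →+* F :=
  (polyEval p x).comp (MvPolynomial.map (Int.castRingHom (ZMod p)))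

/-- The pairs of a rational function and its value after reduction modulo `p`, for the functions
that are defined at the point `x`. -/
def specializationGraph (x : ι → F) : Subring (FractionRing (MvPolynomial ι ℤ) × F) where
  carrier := {fy | ∃ P D : MvPolynomial ι ℤ, specialize p x D ≠ 0 ∧
    fy.1 = algebraMap _ _ P / algebraMap _ _ D ∧ fy.2 = specialize p x P / specialize p x D}
  zero_mem' := ⟨0, 1, by simp, by simp, by simp⟩
  one_mem' := ⟨1, 1, by simp, by simp, by simp⟩
  add_mem' := by
    rintro ⟨f, y⟩ ⟨f', y'⟩ ⟨P, D, hD, hf, hy⟩ ⟨P', D', hD', hf', hy'⟩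
    have nz : ∀ {A : MvPolynomial ι ℤ}, specialize p x A ≠ 0 →
        algebraMap _ (FractionRing (MvPolynomial ι ℤ)) A ≠ 0 := fun hA h0 => hA (by
      rw [(IsFractionRing.to_map_eq_zero_iff (K := FractionRing (MvPolynomial ι ℤ))).mp h0,
        map_zero])
    refine ⟨P * D' + D * P', D * D', by rw [map_mul]; exact mul_ne_zero hD hD', ?_, ?_⟩
    · simp only at hf hf' ⊢
      rw [Prod.fst_add, hf, hf', div_add_div _ _ (nz hD) (nz hD')]; simp only [map_add, map_mul]
    · simp only at hy hy' ⊢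
      rw [Prod.snd_add, hy, hy', div_add_div _ _ hD hD']; simp only [map_add, map_mul]
  mul_mem' := by
    rintro ⟨f, y⟩ ⟨f', y'⟩ ⟨P, D, hD, hf, hy⟩ ⟨P', D', hD', hf', hy'⟩
    refine ⟨P * P', D * D', by rw [map_mul]; exact mul_ne_zero hD hD', ?_, ?_⟩
    · simp only at hf hf' ⊢
      rw [Prod.fst_mul, hf, hf', div_mul_div_comm, map_mul, map_mul]
    · simp only at hy hy' ⊢
      rw [Prod.snd_mul, hy, hy', div_mul_div_comm, map_mul, map_mul]
  neg_mem' := by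
    rintro ⟨f, y⟩ ⟨P, D, hD, hf, hy⟩
    refine ⟨-P, D, hD, ?_, ?_⟩
    · simp only at hf ⊢
      rw [Prod.fst_neg, hf, map_neg, neg_div]
    · simp only at hy ⊢
      rw [Prod.snd_neg, hy, map_neg, neg_div]

variable {p}

theorem algebraMap_mem_specializationGraph (x : ι → F) (P : MvPolynomial ι ℤ) :
    (algebraMap _ _ P, specialize p x P) ∈ specializationGraph p x :=
  ⟨P, 1, by simp, by simp, by simp⟩

/-- The graph is a subring, and it also admits quotients whose denominator does not vanish at the
point. This is what `μ = νη/ω` needs, `ω` being nowhere zero. -/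
theorem div_mem_specializationGraph {x : ι → F} {f f' : FractionRing (MvPolynomial ι ℤ)} {y y' : F}
    (h : (f, y) ∈ specializationGraph p x) (h' : (f', y') ∈ specializationGraph p x)
    (hy' : y' ≠ 0) : (f / f', y / y') ∈ specializationGraph p x := by
  obtain ⟨P, D, hD, hf, hy⟩ := h
  obtain ⟨P', D', hD', hf', hz⟩ := h'
  simp only at hf hf' hy hz
  have hP' : specialize p x P' ≠ 0 := fun h0 => hy' (by rw [hz, h0, zero_div])
  refine ⟨P * D', D * P', by rw [map_mul]; exact mul_ne_zero hD hP', ?_, ?_⟩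
  · rw [hf, hf', div_div_div_eq, map_mul, map_mul]
  · rw [hy, hz, div_div_div_eq, map_mul, map_mul]

/-- A denominator that survives the evaluation is nonzero modulo `p`, so the same fraction may be
used for the reduction and for the evaluation. -/
theorem evalAt_reduceMod [Fact p.Prime] {x : ι → F} {f : FractionRing (MvPolynomial ι ℤ)} {y : F}
    (h : (f, y) ∈ specializationGraph p x) : evalAt (reduceMod p f) x = y := by
  obtain ⟨P, D, hD, hf, hy⟩ := h
  simp only at hf hy
  rw [hf, hy, reduceMod_eq, evalAt_eq]
  · rfl
  · exact hD
  · intro h0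
    exact hD (by rw [specialize, RingHom.comp_apply, h0, map_zero])

end Specialization

/-! ### The bilinear 4-cocycle on colorings -/

section Bilinear

variable {F : Type*} [Field F] {K : PreAbstractSimplicialComplex ℕ}

/-- Adding `κω` to `ν` adds `κη` to `μ`, and `η` is a cocycle. Hence `Q` depends only on colors. -/
theorem bilinearQ_congr_left {v : Finset ℕ} (hv : v.card = 5) (ω : Param (simplex v) F)
    (ν ν' η : Cocycles (simplex v) 3 F)
    (h : (Submodule.Quotient.mk ν : ColorSpace ω) = Submodule.Quotient.mk ν') :
    bilinearQ (simplex v) ω.1.1 ν.1 η.1 (self v hv) =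
      bilinearQ (simplex v) ω.1.1 ν'.1 η.1 (self v hv) := by
  rw [Submodule.Quotient.eq, Submodule.mem_span_singleton] at h
  obtain ⟨κ, hκ⟩ := h
  have h1 : (fun t => ν.1 t * η.1 t / ω.1.1 t) =
      (fun t => ν'.1 t * η.1 t / ω.1.1 t) + κ • η.1 := by
    funext t
    have ht : κ * ω.1.1 t = ν.1 t - ν'.1 t := congrArg (fun z => z.1 t) hκ
    have hω := ω.2 t
    have e : ν.1 t = ν'.1 t + κ * ω.1.1 t := by rw [ht]; ring
    change ν.1 t * η.1 t / ω.1.1 t = ν'.1 t * η.1 t / ω.1.1 t + κ * η.1 t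
    rw [e, add_mul, add_div, mul_right_comm, mul_div_cancel_right₀ _ hω]
  rw [bilinearQ, bilinearQ, h1, map_add, map_smul, LinearMap.mem_ker.mp η.2, smul_zero, add_zero]

theorem bilinearQ_comm (ω ν η : Cochain K 3 F) :
    bilinearQ K ω ν η = bilinearQ K ω η ν := by
  simp only [bilinearQ, mul_comm]

theorem bilinearQ_congr {v : Finset ℕ} (hv : v.card = 5) (ω : Param (simplex v) F)
    (ν ν' η η' : Cocycles (simplex v) 3 F)
    (h : (Submodule.Quotient.mk ν : ColorSpace ω) = Submodule.Quotient.mk ν')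
    (h' : (Submodule.Quotient.mk η : ColorSpace ω) = Submodule.Quotient.mk η') :
    bilinearQ (simplex v) ω.1.1 ν.1 η.1 (self v hv) =
      bilinearQ (simplex v) ω.1.1 ν'.1 η'.1 (self v hv) := by
  rw [bilinearQ_congr_left hv ω ν ν' η h, bilinearQ_comm, bilinearQ_congr_left hv ω η η' ν' h',
    bilinearQ_comm]

/-- The bilinear 4-cochain of two colorings. -/
def coloringQ (ω : Param K F) (r₁ r₂ : Coloring ω) : Cochain K 4 F := fun v =>
  bilinearQ (simplex v.1) (ω.restrict (simplex_le v.2.1)).1.1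
    (Quotient.out (r₁ v)).1 (Quotient.out (r₂ v)).1 (self v.1 v.2.2)

theorem coloringQ_coloringOf (ω : Param K F) (ν η : Cocycles K 3 F) :
    coloringQ ω (coloringOf ω ν) (coloringOf ω η) = bilinearQ K ω.1.1 ν.1 η.1 := by
  funext v
  exact bilinearQ_congr v.2.2 (ω.restrict (simplex_le v.2.1)) _
    (restrict 3 F (simplex_le v.2.1) ν) _ (restrict 3 F (simplex_le v.2.1) η)
    (Quotient.out_eq _) (Quotient.out_eq _)

/-- There need be no global `μ`, but the condition is local: on one 5-simplex the colors come from
cocycles and `Q = δμ`. -/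
theorem coboundary_coloringQ {ω : Param K F} (r₁ r₂ : Permitted ω) :
    coboundary K 4 F (coloringQ ω r₁.1 r₂.1) = 0 := by
  funext w
  obtain ⟨ν, hν⟩ := r₁.2 w
  obtain ⟨η, hη⟩ := r₂.2 w
  have h := congrFun (coboundary_coboundary (K := simplex w.1)
    (fun t => ν.1 t * η.1 t / (ω.restrict (simplex_le w.2.1)).1.1 t)) (self w.1 w.2.2)
  have h2 := coloringQ_coloringOf (ω.restrict (simplex_le w.2.1)) ν η
  rw [← hν, ← hη] at h2
  rw [bilinearQ] at h2
  rw [← h2] at h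
  exact h

end Bilinear

/-! ### The bipolynomial cochains are cocycles -/

section Bipolynomial

variable {F : Type*} [Field F]

/-- For a cocycle the homotopy identity with apex the first vertex reduces to `f = δ(hf)`. The first
vertex is minimal, so its sign is `+1` and `hf` has no extra signs. -/
theorem cocycleOfFree_eq {w : Finset ℕ} {E : Type*} [CommRing E] (f : Cocycles (simplex w) 3 E) :
    cocycleOfFree w (fun t => f.1 t.1) = f.1 := by
  funext t
  rw [cocycleOfFree]
  split_ifs with h
  · rfl
  · have hw : w.Nonempty := t.2.1.1.mono t.2.1.2
    have ha : w.min' hw ∉ t.1 := fun hm => h ⟨_, hm, fun b hb => w.min'_le b hb⟩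
    have h1 := diff_coneHomotopy (w.min' hw) (zeroExt f.1) t.1
    have h2 : diff (zeroExt f.1) (insert (w.min' hw) t.1) = 0 :=
      diff_zeroExt_of_mem_cocycles f ⟨insert (w.min' hw) t.1, ⟨Finset.insert_nonempty _ _,
        Finset.insert_subset (w.min'_mem hw) t.2.1.2⟩,
        by rw [Finset.card_insert_of_notMem ha, t.2.2]⟩
    rw [zeroExt_apply, coneHomotopy, if_neg ha, h2, mul_zero, add_zero] at h1
    rw [← h1, diff, ← Finset.sum_coe_sort t.1 fun i => (sign t.1 i : E) *
      coneHomotopy (w.min' hw) (zeroExt f.1) (t.1.erase i)]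
    refine Finset.sum_congr rfl fun i _ => ?_
    rw [coneHomotopy, if_neg fun hm => ha (Finset.mem_of_mem_erase hm)]
    have hs : sign (insert (w.min' hw) (t.1.erase i)) (w.min' hw) = 1 := by
      rw [sign, Finset.filter_eq_empty_iff.mpr, Finset.card_empty, pow_zero]
      intro b hb
      refine not_lt.mpr (w.min'_le b ?_)
      rcases Finset.mem_insert.mp hb with rfl | hb
      · exact w.min'_mem hw
      · exact t.2.1.2 (Finset.mem_of_mem_erase hb)
    rw [hs, Int.cast_one, one_mul]
    exact congrArg _ (zeroExt_apply f.1 (coneTet t h i).1).symm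

variable (p : ℕ) [Fact p.Prime] (k : ℕ)

/-- The generic `Q` is a coboundary, so the term `(δQ)^(p^k)` is zero and the division by `p` is
carried out by the integer polynomial. -/
theorem genericValue_eq {w : Finset ℕ} (hw : w.card = 6) :
    genericValue p k w hw = powerValue p k (zeroExt (bilinearQ (simplex w) (genericCocycle w 0)
      (genericCocycle w 1) (genericCocycle w 2))) w := by
  have hp : (p : GenericField w) ≠ 0 := by
    rw [← map_natCast (algebraMap (MvPolynomial (Var w) ℤ) (GenericField w))]
    refine fun h0 => (Fact.out : p.Prime).ne_zero ?_
    exact Nat.cast_eq_zero.mp ((IsFractionRing.to_map_eq_zero_iff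
      (K := FractionRing (MvPolynomial (Var w) ℤ))).mp h0)
  have h0 := coboundary_eq_diff_zeroExt (bilinearQ (simplex w) (genericCocycle w 0)
    (genericCocycle w 1) (genericCocycle w 2)) (self w hw)
  rw [show coboundary (simplex w) 4 _ (bilinearQ (simplex w) (genericCocycle w 0)
    (genericCocycle w 1) (genericCocycle w 2)) = 0 from coboundary_coboundary _,
    Pi.zero_apply] at h0
  change 0 = diff _ w at h0
  rw [genericValue, div_eq_iff hp, mul_comm, mul_powerValue, ← h0,
    zero_pow (pow_ne_zero k (Fact.out : p.Prime).ne_zero), sub_zero]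
  exact coboundary_eq_diff _ _ (fun t => by rw [zeroExt_apply]) (self w hw)

variable [CharP F p]

/-- The polynomial can be evaluated inside the subring; the two projections then give the two
components. -/
theorem powerValue_mem_specializationGraph {ι : Type} {x : ι → F}
    (V : Finset ℕ → FractionRing (MvPolynomial ι ℤ)) (V' : Finset ℕ → F)
    (h : ∀ v, (V v, V' v) ∈ specializationGraph p x) (w : Finset ℕ) :
    (powerValue p k V w, powerValue p k V' w) ∈ specializationGraph p x := by
  have e : (powerValue p k V w, powerValue p k V' w) = (powerValue p k
      (fun v => (⟨(V v, V' v), h v⟩ : specializationGraph p x)) w).1 := by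
    have h1 := map_powerValue p k ((RingHom.fst _ _).comp (specializationGraph p x).subtype)
      (fun v => (⟨(V v, V' v), h v⟩ : specializationGraph p x)) w
    have h2 := map_powerValue p k ((RingHom.snd _ _).comp (specializationGraph p x).subtype)
      (fun v => (⟨(V v, V' v), h v⟩ : specializationGraph p x)) w
    exact Prod.ext h1.symm h2.symm
  rw [e]
  exact Subtype.property _

/-- This frees the definition from generic cocycles and chosen representatives. The generic `ω`,
`ν`, `η` specialize to the actual ones: independent components by substitution, the others as
integer combinations of these. Then `Q`, and then the polynomial in `Q`, specialize as well. -/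
theorem bipolynomialCocycle_eq {w : Finset ℕ} (hw : w.card = 6) (ω : Param (simplex w) F)
    (r₁ r₂ : Permitted ω) : bipolynomialCocycle p k F w hw ω r₁ r₂ =
      powerValue p k (zeroExt (coloringQ ω r₁.1 r₂.1)) w := by
  have h1 : r₁.1 = coloringOf ω (representative hw r₁) := (r₁.2 (self w hw)).choose_spec
  have h2 : r₂.1 = coloringOf ω (representative hw r₂) := (r₂.2 (self w hw)).choose_spec
  rw [h1, h2, coloringQ_coloringOf, bipolynomialCocycle, genericValue_eq]
  set x : Var w → F := fun jt =>
    (![ω.1, representative hw r₁, representative hw r₂] jt.1).1 jt.2.1 with hx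
  have hg : ∀ (j : Fin 3) (t : Simplices (simplex w) 3),
      (genericCocycle w j t, (![ω.1, representative hw r₁, representative hw r₂] j).1 t) ∈
        specializationGraph p x := by
    intro j t
    have hX : ∀ t', (algebraMap (MvPolynomial (Var w) ℤ) (GenericField w)
        (MvPolynomial.X (j, t')), x (j, t')) ∈ specializationGraph p x := by
      intro t'
      have := algebraMap_mem_specializationGraph (p := p) x (MvPolynomial.X (j, t'))
      rwa [show specialize p x (MvPolynomial.X (j, t')) = x (j, t') by
        simp [specialize, polyEval]] at this
    rw [← cocycleOfFree_eq (![ω.1, representative hw r₁, representative hw r₂] j), genericCocycle]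
    simp only [cocycleOfFree]
    split_ifs with h
    · exact hX _
    · have := Subring.sum_mem (specializationGraph p x) (t := Finset.univ) fun (i : t.1) _ =>
        (specializationGraph p x).mul_mem
          (intCast_mem (specializationGraph p x) (sign t.1 i)) (hX (coneTet t h i))
      convert this using 1
      refine Prod.ext ?_ ?_
      · simp [Prod.fst_sum]
      · simp [Prod.snd_sum, hx]
  have hQ : ∀ v : Simplices (simplex w) 4, (bilinearQ (simplex w) (genericCocycle w 0)
      (genericCocycle w 1) (genericCocycle w 2) v, bilinearQ (simplex w) ω.1.1
        (representative hw r₁).1 (representative hw r₂).1 v) ∈ specializationGraph p x := by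
    intro v
    have := Subring.sum_mem (specializationGraph p x) (t := Finset.univ) fun (i : v.1) _ =>
      (specializationGraph p x).mul_mem (intCast_mem (specializationGraph p x) (sign v.1 i))
        (div_mem_specializationGraph
          ((specializationGraph p x).mul_mem (hg 1 (face v i)) (hg 2 (face v i)))
          (hg 0 (face v i)) (ω.2 _))
    convert this using 1
    refine Prod.ext ?_ ?_
    · simp [Prod.fst_sum, bilinearQ, coboundary]
    · simp [Prod.snd_sum, bilinearQ, coboundary]
  have hV : ∀ v : Finset ℕ, (zeroExt (bilinearQ (simplex w) (genericCocycle w 0)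
      (genericCocycle w 1) (genericCocycle w 2)) v, zeroExt (bilinearQ (simplex w) ω.1.1
        (representative hw r₁).1 (representative hw r₂).1) v) ∈ specializationGraph p x := by
    intro v
    rw [zeroExt, zeroExt]
    split_ifs with h
    · exact hQ _
    · exact (specializationGraph p x).zero_mem
  exact evalAt_reduceMod (powerValue_mem_specializationGraph p k _ _ hV w)

theorem isCocycle_bipolynomialCocycle : (bipolynomialCocycle p k F).IsCocycle := by
  intro u hu ω r₁ r₂
  have hne : u.Nonempty := Finset.card_pos.mp (by omega)
  obtain ⟨a, ha⟩ := hne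
  -- A simplex is a cone from any of its vertices, so the 4-cocycle `Q` is a coboundary on it.
  obtain ⟨U, hU⟩ := exists_coboundary_eq (K := simplex u) (a := a)
    (fun t ht => ⟨Finset.insert_nonempty _ _, Finset.insert_subset ha ht.2⟩)
    ⟨coloringQ ω r₁.1 r₂.1, LinearMap.mem_ker.mpr (coboundary_coloringQ r₁ r₂)⟩
  have h := congrFun (diff_powerValue_diff p k (zeroExt U)) u
  rw [Pi.zero_apply] at h
  rw [← h, diff, ← Finset.sum_coe_sort u fun i => (sign u i : F) *
    powerValue p k (diff (zeroExt U)) (u.erase i)]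
  refine Finset.sum_congr rfl fun i _ => ?_
  rw [bipolynomialCocycle_eq]
  congr 1
  refine powerValue_congr p k fun j hj => ?_
  have hc : (u.erase i).card = 6 := by rw [Finset.card_erase_of_mem i.2, hu]
  have hc' : ((u.erase i).erase j).card = 5 := by rw [Finset.card_erase_of_mem hj, hc]
  have hn : ((u.erase i).erase j).Nonempty := Finset.card_pos.mp (by omega)
  have e1 := zeroExt_apply (coloringQ (ω.restrict (simplex_mono (Finset.erase_subset i.1 u)))
    (restrictPermitted r₁ (simplex_mono (Finset.erase_subset i.1 u))).1
    (restrictPermitted r₂ (simplex_mono (Finset.erase_subset i.1 u))).1)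
    ⟨(u.erase i).erase j, ⟨hn, Finset.erase_subset _ _⟩, hc'⟩
  have e2 := coboundary_eq_diff_zeroExt U
    ⟨(u.erase i).erase j, ⟨hn, (Finset.erase_subset _ _).trans (Finset.erase_subset _ _)⟩, hc'⟩
  rw [hU] at e2
  exact e1.trans e2

end Bipolynomial

/-! ### Invariants of stellar equivalence -/

section Stellar

theorem StellarEquiv.iff {P : PreAbstractSimplicialComplex ℕ → Prop}
    (hP : ∀ K, ∀ A ∈ K.faces, ∀ a : ℕ, {a} ∉ K.faces → (P K ↔ P (stellarSubdivision K A a)))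
    {K L : PreAbstractSimplicialComplex ℕ} (h : StellarEquiv K L) : P K ↔ P L := by
  induction h with
  | rel K L h =>
    obtain ⟨A, hA, a, ha, rfl⟩ := h
    exact hP K A hA a ha
  | refl K => rfl
  | symm K L _ ih => exact ih.symm
  | trans K L M _ _ ih ih' => exact ih.trans ih'

variable {K : PreAbstractSimplicialComplex ℕ} {A : Finset ℕ} {a : ℕ}

theorem face_nonempty {t : Finset ℕ} (ht : t ∈ K.faces) : t.Nonempty :=
  (K.isRelLowerSet_faces ht).1

theorem face_mono {s t : Finset ℕ} (ht : t ∈ K.faces) (h : s ⊆ t) (hs : s.Nonempty) :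
    s ∈ K.faces :=
  K.isRelLowerSet_faces.mem_of_le ht h hs

theorem ne_of_mem_face (ha : {a} ∉ K.faces) {t : Finset ℕ} (ht : t ∈ K.faces) {i : ℕ}
    (hi : i ∈ t) : i ≠ a := by
  rintro rfl
  exact ha (face_mono ht (Finset.singleton_subset_iff.mpr hi) (Finset.singleton_nonempty _))

theorem mem_stellarSubdivision_of_not_subset {t : Finset ℕ} (ht : t ∈ K.faces) (hA : ¬A ⊆ t) :
    t ∈ (stellarSubdivision K A a).faces :=
  Or.inl ⟨ht, hA⟩

theorem insert_mem_stellarSubdivision {t : Finset ℕ} (hat : a ∉ t) (hA : ¬A ⊆ t)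
    (ht : t ∪ A ∈ K.faces) : insert a t ∈ (stellarSubdivision K A a).faces := by
  refine Or.inr ⟨Finset.mem_insert_self _ _, ?_, ?_⟩
  · rwa [Finset.erase_insert hat]
  · rwa [Finset.erase_insert hat]

/-- Collapsing the new vertex of a stellar subdivision to a vertex `u` of the subdivided simplex is
a simplicial map. -/
theorem image_mem_of_mem_stellarSubdivision (ha : {a} ∉ K.faces) {u : ℕ} (hu : u ∈ A)
    {t : Finset ℕ} (ht : t ∈ (stellarSubdivision K A a).faces) :
    t.image (fun i => if i = a then u else i) ∈ K.faces := by
  have hne : (t.image (fun i => if i = a then u else i)).Nonempty := (face_nonempty ht).image _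
  rcases ht with ⟨ht, -⟩ | ⟨-, -, ht⟩
  · refine face_mono ht (Finset.image_subset_iff.mpr fun i hi => ?_) hne
    rwa [if_neg (ne_of_mem_face ha ht hi)]
  · refine face_mono ht (Finset.image_subset_iff.mpr fun i hi => ?_) hne
    split_ifs with h
    · exact Finset.mem_union_right _ hu
    · exact Finset.mem_union_left _ (Finset.mem_erase.mpr ⟨h, hi⟩)

/-- The complex consists of two points. -/
def IsTwoPoints (K : PreAbstractSimplicialComplex ℕ) : Prop :=
  ∃ x y : ℕ, x ≠ y ∧ ∀ t, t ∈ K.faces ↔ t = {x} ∨ t = {y}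

/-- A zero-dimensional complex can only be subdivided at a vertex, which renames that vertex. -/
theorem isTwoPoints_stellarSubdivision_iff (hA : A ∈ K.faces) (ha : {a} ∉ K.faces) :
    IsTwoPoints K ↔ IsTwoPoints (stellarSubdivision K A a) := by
  have key : ∀ {x y : ℕ}, x ≠ y → (∀ t, t ∈ K.faces ↔ t = {x} ∨ t = {y}) → A = {x} →
      IsTwoPoints (stellarSubdivision K A a) := by
    rintro x y hxy hK rfl
    have hya : y ≠ a := ne_of_mem_face ha ((hK {y}).mpr (Or.inr rfl)) (Finset.mem_singleton_self y)
    refine ⟨a, y, hya.symm, fun t => ⟨?_, ?_⟩⟩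
    · rintro (⟨ht, hs⟩ | ⟨hat, hs, ht⟩)
      · rcases (hK t).mp ht with rfl | rfl
        · exact absurd subset_rfl hs
        · exact Or.inr rfl
      · left
        refine Finset.eq_singleton_iff_unique_mem.mpr ⟨hat, fun i hi => ?_⟩
        by_contra hia
        have hx : x ∉ t.erase a := fun h => hs (Finset.singleton_subset_iff.mpr h)
        have hi' : i ∈ t.erase a := Finset.mem_erase.mpr ⟨hia, hi⟩
        have h1 : i ∈ t.erase a ∪ {x} := Finset.mem_union_left _ hi'
        have h2 : x ∈ t.erase a ∪ {x} := Finset.mem_union_right _ (Finset.mem_singleton_self x)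
        rcases (hK _).mp ht with h | h
        · rw [h, Finset.mem_singleton] at h1
          exact hx (h1 ▸ hi')
        · rw [h, Finset.mem_singleton] at h2
          exact hxy h2
    · rintro (rfl | rfl)
      · have := insert_mem_stellarSubdivision (K := K) (A := {x}) (t := ∅) (Finset.notMem_empty a)
          (by simp) (by simpa using hA)
        simpa using this
      · refine mem_stellarSubdivision_of_not_subset ((hK _).mpr (Or.inr rfl)) ?_
        simpa using hxy
  constructor
  · rintro ⟨x, y, hxy, hK⟩
    rcases (hK A).mp hA with h | h
    · exact key hxy hK h
    · exact key hxy.symm (fun t => (hK t).trans or_comm) h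
  · rintro ⟨x, y, hxy, hK⟩
    obtain ⟨i, hi⟩ := face_nonempty hA
    have hsing : ∀ {t}, t ∈ (stellarSubdivision K A a).faces → a ∈ t → t = {a} := by
      intro t ht hat
      rcases (hK t).mp ht with rfl | rfl <;> rw [Finset.mem_singleton.mp hat]
    have hai : a ≠ i := (ne_of_mem_face ha hA hi).symm
    -- Otherwise the subdivision would contain the edge `{a, i}`.
    have hAi : A = {i} := by
      by_contra hne
      have h1 : ¬A ⊆ {i} := fun h =>
        hne ((Finset.subset_singleton_iff.mp h).resolve_left (face_nonempty hA).ne_empty)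
      have h2 := insert_mem_stellarSubdivision (a := a) (by simpa using hai) h1
        (by rwa [Finset.union_eq_right.mpr (Finset.singleton_subset_iff.mpr hi)])
      have h3 := hsing h2 (Finset.mem_insert_self _ _)
      have h4 : i ∈ insert a ({i} : Finset ℕ) := by simp
      rw [h3, Finset.mem_singleton] at h4
      exact hai h4.symm
    subst hAi
    have haK : {a} ∈ (stellarSubdivision K {i} a).faces := by
      have := insert_mem_stellarSubdivision (K := K) (A := {i}) (t := ∅) (Finset.notMem_empty a)
        (by simp) (by simpa using hA)
      simpa using this
    obtain ⟨z, hz, hK'⟩ : ∃ z, a ≠ z ∧ ∀ t, t ∈ (stellarSubdivision K {i} a).faces ↔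
        t = {a} ∨ t = {z} := by
      rcases (hK {a}).mp haK with h | h
      · rw [Finset.singleton_inj] at h
        subst h
        exact ⟨y, hxy, hK⟩
      · rw [Finset.singleton_inj] at h
        subst h
        exact ⟨x, hxy.symm, fun t => (hK t).trans or_comm⟩
    have hzK : {z} ∈ K.faces ∧ ¬{i} ⊆ ({z} : Finset ℕ) := by
      rcases (hK' {z}).mpr (Or.inr rfl) with h | h
      · exact h
      · exact absurd (Finset.mem_singleton.mp h.1) hz
    refine ⟨i, z, fun h => hzK.2 (by rw [h]), fun t => ⟨fun ht => ?_, ?_⟩⟩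
    · by_cases hit : i ∈ t
      · left
        refine Finset.eq_singleton_iff_unique_mem.mpr ⟨hit, fun j hj => ?_⟩
        by_contra hji
        have h2 := insert_mem_stellarSubdivision (K := K) (A := {i}) (a := a) (t := {j})
          (by simpa using (ne_of_mem_face ha ht hj).symm)
          (by simpa using Ne.symm hji) (face_mono ht (by
            intro k hk
            rcases Finset.mem_union.mp hk with hk | hk <;> rw [Finset.mem_singleton.mp hk] <;>
            assumption) ⟨j, by simp⟩)
        have h3 := hsing h2 (Finset.mem_insert_self _ _)
        have h4 : j ∈ insert a ({j} : Finset ℕ) := by simp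
        rw [h3, Finset.mem_singleton] at h4
        exact ne_of_mem_face ha ht hj h4
      · right
        have h2 := (hK' t).mp (mem_stellarSubdivision_of_not_subset ht (by simpa using hit))
        refine h2.resolve_left ?_
        rintro rfl
        exact ha ht
    · rintro (rfl | rfl)
      · exact hA
      · exact hzK.1

variable (F : Type*)

/-- The complex is connected: functions that are constant on the edges are constant. -/
def IsEdgeConnected (K : PreAbstractSimplicialComplex ℕ) : Prop :=
  ∀ h : ℕ → F, (∀ i j, {i, j} ∈ K.faces → h i = h j) →
    ∀ i j, {i} ∈ K.faces → {j} ∈ K.faces → h i = h j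

variable {F}

theorem pair_mem_stellarSubdivision (ha : {a} ∉ K.faces) {i j : ℕ} (hij : {i, j} ∈ K.faces)
    (hA : A ⊆ {i, j}) (hi : A ≠ {i}) (hne : A.Nonempty) :
    {a, i} ∈ (stellarSubdivision K A a).faces := by
  refine insert_mem_stellarSubdivision ?_ ?_ ?_
  · rw [Finset.mem_singleton]
    exact (ne_of_mem_face ha hij (Finset.mem_insert_self _ _)).symm
  · exact fun h => hi ((Finset.subset_singleton_iff.mp h).resolve_left hne.ne_empty)
  · exact face_mono hij (Finset.union_subset (by simp) hA) ⟨i, by simp⟩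

/-- Functions pass from `K` to the subdivision by pullback along the collapse of `a` to `u`. In the
other direction they are restricted, with `a` standing for the subdivided simplex when that is a
vertex; an edge lost in the subdivision is replaced by a path through `a`. -/
theorem isEdgeConnected_stellarSubdivision_iff (hA : A ∈ K.faces) (ha : {a} ∉ K.faces) :
    IsEdgeConnected F K ↔ IsEdgeConnected F (stellarSubdivision K A a) := by
  obtain ⟨u, hu⟩ := face_nonempty hA
  have hsub : ∀ {i}, A ⊆ {i} → A = {i} := fun h =>
    (Finset.subset_singleton_iff.mp h).resolve_left (face_nonempty hA).ne_empty
  constructor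
  · intro hK h' hh'
    set h : ℕ → F := fun i => if A = {i} then h' a else h' i with hh
    have hnew : ∀ i j, {i, j} ∈ K.faces → A ⊆ {i, j} → h i = h' a := by
      intro i j hij hs
      by_cases hi : A = {i}
      · rw [hh]; exact if_pos hi
      · rw [hh]
        exact (if_neg hi).trans
          (hh' a i (pair_mem_stellarSubdivision ha hij hs hi ⟨u, hu⟩)).symm
    have hedge : ∀ i j, {i, j} ∈ K.faces → h i = h j := by
      intro i j hij
      by_cases hs : A ⊆ {i, j}
      · rw [hnew i j hij hs]
        rw [Finset.pair_comm] at hij hs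
        rw [hnew j i hij hs]
      · have hi : A ≠ {i} := fun e => hs (by rw [e]; simp)
        have hj : A ≠ {j} := fun e => hs (by rw [e]; simp)
        simp only [hh, if_neg hi, if_neg hj]
        exact hh' i j (mem_stellarSubdivision_of_not_subset hij hs)
    have hvert : ∀ i, {i} ∈ (stellarSubdivision K A a).faces →
        ∃ j, {j} ∈ K.faces ∧ h j = h' i := by
      rintro i (⟨hi, hs⟩ | ⟨hi, -, -⟩)
      · refine ⟨i, hi, if_neg fun e => hs (by rw [e])⟩
      · rw [Finset.mem_singleton] at hi
        subst hi
        have huK : {u} ∈ K.faces := face_mono hA (by simpa using hu) (by simp)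
        refine ⟨u, huK, ?_⟩
        by_cases e : A = {u}
        · exact if_pos e
        · have hm : {a, u} ∈ (stellarSubdivision K A a).faces := by
            refine insert_mem_stellarSubdivision ?_ (fun h => e (hsub h)) ?_
            · simpa using (ne_of_mem_face ha hA hu).symm
            · rwa [Finset.union_eq_right.mpr (by simpa using hu)]
          exact (if_neg e).trans (hh' a u hm).symm
    intro i j hi hj
    obtain ⟨i', hi', ei⟩ := hvert i hi
    obtain ⟨j', hj', ej⟩ := hvert j hj
    rw [← ei, ← ej]
    exact hK h hedge i' j' hi' hj'
  · intro hK' h hh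
    have hvert : ∀ i, {i} ∈ K.faces → ∃ j, {j} ∈ (stellarSubdivision K A a).faces ∧
        h (if j = a then u else j) = h i := by
      intro i hi
      by_cases e : A = {i}
      · subst e
        rw [Finset.mem_singleton] at hu
        subst hu
        refine ⟨a, ?_, by rw [if_pos rfl]⟩
        have := insert_mem_stellarSubdivision (K := K) (A := {u}) (t := ∅) (Finset.notMem_empty a)
          (by simp) (by simpa using hA)
        simpa using this
      · exact ⟨i, mem_stellarSubdivision_of_not_subset hi fun h => e (hsub h),
          by rw [if_neg (ne_of_mem_face ha hi (Finset.mem_singleton_self i))]⟩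
    intro i j hi hj
    obtain ⟨i', hi', ei⟩ := hvert i hi
    obtain ⟨j', hj', ej⟩ := hvert j hj
    rw [← ei, ← ej]
    refine hK' (fun i => h (if i = a then u else i)) (fun k l hkl => hh _ _ ?_) i' j' hi' hj'
    have := image_mem_of_mem_stellarSubdivision ha hu hkl
    rwa [Finset.image_insert, Finset.image_singleton] at this

theorem IsClosedPLManifold.isTwoPoints_link {n : ℕ} (hK : IsClosedPLManifold n K) {s : Finset ℕ}
    (hs : s ∈ K.faces) (hc : s.card = n) : IsTwoPoints (link K s) := by
  have h := hK.link_sphere s hs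
  rw [hc, show n + 2 - n = 2 by omega] at h
  refine (StellarEquiv.iff (P := IsTwoPoints)
    (fun K A hA a ha => isTwoPoints_stellarSubdivision_iff hA ha) h).mpr
    ⟨0, 1, by norm_num, fun t => ⟨fun ht => ?_, ?_⟩⟩
  · have h1 := ht.1
    have h2 : t.card < 2 := by simpa using Finset.card_lt_card ht.2
    obtain ⟨x, rfl⟩ := Finset.card_eq_one.mp (by have := h1.card_pos; omega : t.card = 1)
    have h3 := ht.2.subset (Finset.mem_singleton_self x)
    rw [Finset.mem_range] at h3
    interval_cases x <;> simp
  · rintro (rfl | rfl)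
    · exact ⟨by simp, by decide⟩
    · exact ⟨by simp, by decide⟩

theorem IsClosedPLManifold.isEdgeConnected_link {n : ℕ} (hK : IsClosedPLManifold n K)
    {s : Finset ℕ} (hs : s ∈ K.faces) (hc : s.card + 1 = n) : IsEdgeConnected F (link K s) := by
  have h := hK.link_sphere s hs
  rw [show n + 2 - s.card = 3 by omega] at h
  refine (StellarEquiv.iff (P := IsEdgeConnected F)
    (fun K A hA a ha => isEdgeConnected_stellarSubdivision_iff hA ha) h).mpr
    fun f hf i j hi hj => ?_
  have hi' := hi.2.subset (Finset.mem_singleton_self i)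
  have hj' := hj.2.subset (Finset.mem_singleton_self j)
  rw [Finset.mem_range] at hi' hj'
  refine hf i j ⟨by simp, Finset.ssubset_iff_subset_ne.mpr ⟨?_, fun e => ?_⟩⟩
  · exact Finset.insert_subset (by simpa using hi') (by simpa using hj')
  · have h1 := congrArg Finset.card e
    have h2 := Finset.card_le_two (a := i) (b := j)
    rw [Finset.card_range] at h1
    omega

variable (F) [Field F]

/-- The first cohomology of the complex vanishes. -/
def HasTrivialH1 (K : PreAbstractSimplicialComplex ℕ) : Prop :=
  ∀ c : ℕ → ℕ → F, (∀ i j k, {i, j, k} ∈ K.faces → c i j + c j k = c i k) →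
    ∃ f : ℕ → F, ∀ i j, {i, j} ∈ K.faces → c i j = f j - f i

variable {F}

/-- Cocycles are transferred as the functions of vertices were for connectedness. Degenerate triples
are included in the cocycle condition, so `i, i, i` gives `c i i = 0` and `i, j, i` gives
antisymmetry. -/
theorem hasTrivialH1_stellarSubdivision_iff (hA : A ∈ K.faces) (ha : {a} ∉ K.faces) :
    HasTrivialH1 F K ↔ HasTrivialH1 F (stellarSubdivision K A a) := by
  obtain ⟨u, hu⟩ := face_nonempty hA
  have hsub : ∀ {i}, A ⊆ {i} → A = {i} := fun h =>
    (Finset.subset_singleton_iff.mp h).resolve_left (face_nonempty hA).ne_empty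
  constructor
  · intro hK c' hc'
    set g : ℕ → F := fun i => if A = {i} then 0 else c' i a with hg
    -- On an edge containing `A`, hence lost in the subdivision, the value is taken along the path
    -- `i, a, j`. If `A = {i}`, then `a` takes the place of `i`, whence `g i = 0`.
    set c : ℕ → ℕ → F := fun i j => if A ⊆ {i, j} then g i - g j else c' i j with hcdef
    have claim : ∀ x y, {x, y} ∪ A ∈ K.faces → c x y = g x - g y := by
      intro x y hxy
      by_cases hs : A ⊆ {x, y}
      · exact if_pos hs
      · have hx : A ≠ {x} := fun e => hs (by rw [e]; simp)
        have hy : A ≠ {y} := fun e => hs (by rw [e]; simp)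
        have hm : insert a {x, y} ∈ (stellarSubdivision K A a).faces := by
          refine insert_mem_stellarSubdivision (fun h => ?_) hs hxy
          exact ne_of_mem_face ha hxy (Finset.mem_union_left _ h) rfl
        have h1 := hc' x y a (by rwa [Finset.pair_comm y a, Finset.insert_comm x a])
        simp only [hcdef, hg, if_neg hs, if_neg hx, if_neg hy]
        rw [← h1]; ring
    obtain ⟨f, hf⟩ := hK c (by
      intro i j k hijk
      by_cases hs : A ⊆ {i, j, k}
      · have hm : ∀ x y, x ∈ ({i, j, k} : Finset ℕ) → y ∈ ({i, j, k} : Finset ℕ) →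
            {x, y} ∪ A ∈ K.faces := fun x y hx hy =>
          face_mono hijk (Finset.union_subset (Finset.insert_subset hx
            (Finset.singleton_subset_iff.mpr hy)) hs) ⟨x, by simp⟩
        rw [claim i j (hm i j (by simp) (by simp)), claim j k (hm j k (by simp) (by simp)),
          claim i k (hm i k (by simp) (by simp))]
        ring
      · have h1 : ¬A ⊆ {i, j} := fun h => hs (h.trans (by simp))
        have h2 : ¬A ⊆ {j, k} := fun h => hs (h.trans (by simp))
        have h3 : ¬A ⊆ {i, k} := fun h => hs (h.trans (by simp))
        simp only [hcdef, if_neg h1, if_neg h2, if_neg h3]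
        exact hc' i j k (mem_stellarSubdivision_of_not_subset hijk hs))
    -- The value at `a` is forced by the edge from `u` to `a`; for `A = {u}` it is `f u`, since `a`
    -- replaces `u`.
    refine ⟨fun i => if i = a then f u + g u else f i, ?_⟩
    have hnew : ∀ j, j ≠ a → {a, j} ∈ (stellarSubdivision K A a).faces → ¬A ⊆ {j} →
        {j} ∪ A ∈ K.faces → c' a j = f j - (f u + g u) ∧ c' j a = (f u + g u) - f j := by
      intro j hja hj hs hjA
      have h0 := hc' a a a (face_mono hj (by simp) (by simp))
      have h1 := hc' a j a (by rwa [Finset.pair_comm j a, Finset.insert_idem])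
      have hju : {j, u} ∪ A ∈ K.faces :=
        face_mono hjA (Finset.union_subset (Finset.insert_subset (by simp)
          (Finset.singleton_subset_iff.mpr (Finset.mem_union_right _ hu)))
          Finset.subset_union_right) ⟨j, by simp⟩
      have h2 := claim j u hju
      rw [hf j u (face_mono hju Finset.subset_union_left (by simp))] at h2
      have h3 : g j = c' j a := if_neg fun e => hs (by rw [e])
      rw [h3] at h2
      constructor
      · linear_combination h1 + h0 + h2
      · linear_combination -h2
    intro i j hij
    dsimp only
    rcases id hij with ⟨hijK, hs⟩ | ⟨haij, hs, ht⟩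
    · rw [if_neg (ne_of_mem_face ha hijK (by simp)), if_neg (ne_of_mem_face ha hijK (by simp)),
        ← hf i j hijK]
      exact (if_neg hs).symm
    · by_cases hi : i = a
      · subst hi
        by_cases hj : j = i
        · subst hj
          have h0 := hc' j j j (by simpa using hij)
          rw [sub_self]; linear_combination h0
        · have he : ({i, j} : Finset ℕ).erase i = {j} :=
            Finset.erase_insert (by simpa using Ne.symm hj)
          rw [he] at hs ht
          rw [if_neg hj, if_pos rfl]
          exact (hnew j hj hij hs ht).1
      · have hj : a = j := by simpa [Ne.symm hi] using haij
        subst hj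
        have he : ({i, a} : Finset ℕ).erase a = {i} := by
          rw [Finset.pair_comm]; exact Finset.erase_insert (by simpa using Ne.symm hi)
        rw [he] at hs ht
        rw [if_neg hi, if_pos rfl]
        rw [Finset.pair_comm] at hij
        exact (hnew i hi hij hs ht).2
  · intro hK' c hc
    obtain ⟨f', hf'⟩ := hK' (fun i j => c (if i = a then u else i) (if j = a then u else j)) (by
      intro i j k hijk
      refine hc _ _ _ ?_
      have := image_mem_of_mem_stellarSubdivision ha hu hijk
      rwa [Finset.image_insert, Finset.image_insert, Finset.image_singleton] at this)
    set f : ℕ → F := fun i => if A = {i} then f' a else f' i with hf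
    refine ⟨f, ?_⟩
    have claim : ∀ i j, {i, j} ∈ K.faces → A ⊆ {i, j} → c u i = f i - f' a := by
      intro i j hij hs
      by_cases e : A = {i}
      · have hui : u = i := by rwa [e, Finset.mem_singleton] at hu
        subst hui
        have h0 := hc u u u (face_mono hij (by simp) (by simp))
        simp only [hf, if_pos e, sub_self]
        linear_combination h0
      · have h1 := hf' a i (pair_mem_stellarSubdivision ha hij hs e ⟨u, hu⟩)
        rw [if_pos rfl, if_neg (ne_of_mem_face ha hij (by simp))] at h1
        simp only [hf, if_neg e]
        exact h1
    intro i j hij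
    by_cases hs : A ⊆ {i, j}
    · have h1 := claim i j hij hs
      have h2 := claim j i (by rwa [Finset.pair_comm]) (by rwa [Finset.pair_comm])
      have h3 := hc u i j (face_mono hij (Finset.insert_subset (hs hu) subset_rfl) ⟨u, by simp⟩)
      linear_combination h3 - h1 + h2
    · have hi : A ≠ {i} := fun e => hs (by rw [e]; simp)
      have hj : A ≠ {j} := fun e => hs (by rw [e]; simp)
      have h1 := hf' i j (mem_stellarSubdivision_of_not_subset hij hs)
      rw [if_neg (ne_of_mem_face ha hij (by simp)), if_neg (ne_of_mem_face ha hij (by simp))] at h1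
      simp only [hf, if_neg hi, if_neg hj]
      exact h1

/-- In the boundary of a tetrahedron every three vertices span a face, so `c 0` is a potential of
`c`. -/
theorem IsClosedPLManifold.hasTrivialH1_link {n : ℕ} (hK : IsClosedPLManifold n K)
    {s : Finset ℕ} (hs : s ∈ K.faces) (hc : s.card + 2 = n) : HasTrivialH1 F (link K s) := by
  have h := hK.link_sphere s hs
  rw [show n + 2 - s.card = 4 by omega] at h
  refine (StellarEquiv.iff (P := HasTrivialH1 F)
    (fun K A hA a ha => hasTrivialH1_stellarSubdivision_iff hA ha) h).mpr fun c hcc =>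
    ⟨fun i => c 0 i, fun i j hij => ?_⟩
  have h1 := hcc 0 i j ⟨by simp, Finset.ssubset_iff_subset_ne.mpr ⟨?_, fun e => ?_⟩⟩
  · exact eq_sub_of_add_eq' h1
  · exact Finset.insert_subset (by simp) hij.2.subset
  · have h1 := congrArg Finset.card e
    have h2 := Finset.card_le_three (a := 0) (b := i) (c := j)
    rw [Finset.card_range] at h1
    omega

end Stellar

/-! ### Incidence numbers -/

section Incidence

variable {F : Type*} [Field F]

/-- The incidence number of `w` and `v` as an element of `F`. -/
def inc (F : Type*) [Field F] (w v : Finset ℕ) : F := diff (fun u => if u = v then 1 else 0) w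

theorem intCast_incidence (w v : Finset ℕ) : ((incidence w v : ℤ) : F) = inc F w v := by
  rw [incidence, inc, diff, Int.cast_sum]
  refine Finset.sum_congr rfl fun i _ => ?_
  split_ifs <;> simp

theorem inc_erase {w : Finset ℕ} {i : ℕ} (hi : i ∈ w) : inc F w (w.erase i) = sign w i := by
  rw [inc, diff, Finset.sum_eq_single_of_mem i hi]
  · rw [if_pos rfl, mul_one]
  · intro j hj hji
    rw [if_neg, mul_zero]
    intro h
    have : j ∈ w.erase i := Finset.mem_erase.mpr ⟨hji, hj⟩
    rw [← h] at this
    exact Finset.notMem_erase j w this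

theorem inc_ne_zero {w v : Finset ℕ} (h : inc F w v ≠ 0) : ∃ i ∈ w, v = w.erase i := by
  obtain ⟨i, hi, hne⟩ := Finset.exists_ne_zero_of_sum_ne_zero h
  refine ⟨i, hi, ?_⟩
  by_contra hv
  exact hne (by dsimp only; rw [if_neg fun e => hv e.symm, mul_zero])

theorem inc_eq_zero_of_not_subset {w v : Finset ℕ} (h : ¬v ⊆ w) : inc F w v = 0 := by
  by_contra hne
  obtain ⟨i, -, rfl⟩ := inc_ne_zero hne
  exact h (Finset.erase_subset _ _)

theorem intCast_sign_mul_self (s : Finset ℕ) (i : ℕ) : (sign s i : F) * sign s i = 1 := by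
  rw [← Int.cast_mul, sign_mul_self, Int.cast_one]

theorem intCast_sign_ne_zero (s : Finset ℕ) (i : ℕ) : (sign s i : F) ≠ 0 :=
  left_ne_zero_of_mul_eq_one (intCast_sign_mul_self s i)

/-- The `n`-simplices of `K` that contain `s`. -/
abbrev StarSimplices (K : PreAbstractSimplicialComplex ℕ) (s : Finset ℕ) (n : ℕ) : Type :=
  {t : Simplices K n // s ⊆ t.1}

variable {K : PreAbstractSimplicialComplex ℕ} {s : Finset ℕ}
  [∀ n, Fintype (StarSimplices K s n)]

/-- The facets of `w` that contain `s` are those opposite the vertices outside `s`. -/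
theorem sum_inc_mul {n : ℕ} (w : StarSimplices K s (n + 1)) (φ : Finset ℕ → F) :
    ∑ v : StarSimplices K s n, inc F w.1.1 v.1.1 * φ v.1.1 =
      ∑ i ∈ w.1.1 \ s, (sign w.1.1 i : F) * φ (w.1.1.erase i) := by
  have h : ∀ v : StarSimplices K s n, inc F w.1.1 v.1.1 * φ v.1.1 =
      ∑ i ∈ w.1.1 \ s, if w.1.1.erase i = v.1.1 then (sign w.1.1 i : F) * φ v.1.1 else 0 := by
    intro v
    rw [inc, diff, Finset.sum_mul, ← Finset.sum_subset Finset.sdiff_subset]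
    · refine Finset.sum_congr rfl fun i _ => ?_
      split_ifs <;> simp
    · intro i hi his
      have his' : i ∈ s := by
        by_contra h; exact his (Finset.mem_sdiff.mpr ⟨hi, h⟩)
      rw [if_neg, mul_zero, zero_mul]
      intro h
      have := v.2 his'
      rw [← h] at this
      exact Finset.notMem_erase i _ this
  rw [Finset.sum_congr rfl fun v _ => h v, Finset.sum_comm]
  refine Finset.sum_congr rfl fun i hi => ?_
  obtain ⟨hiw, his⟩ := Finset.mem_sdiff.mp hi
  have hs : s ⊆ w.1.1.erase i := Finset.subset_erase.mpr ⟨w.2, his⟩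
  rw [Finset.sum_eq_single (⟨face w.1 ⟨i, hiw⟩, hs⟩ : StarSimplices K s n)]
  · exact if_pos rfl
  · intro v _ hv
    refine if_neg fun e => hv (Subtype.ext (Subtype.ext e.symm))
  · intro h; exact absurd (Finset.mem_univ _) h

/-- This is `diff_diff` for the indicator of `t`; faces that miss a vertex of `s` do not contain
`t`, so leaving them out changes nothing. -/
theorem sum_inc_mul_inc {n : ℕ} (w : StarSimplices K s (n + 1)) {t : Finset ℕ} (ht : s ⊆ t) :
    ∑ v : StarSimplices K s n, inc F w.1.1 v.1.1 * inc F v.1.1 t = 0 := by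
  rw [sum_inc_mul w fun v => inc F v t]
  have h : diff (fun v => inc F v t) w.1.1 = 0 := by
    have := congrFun (diff_diff (R := F) fun u => if u = t then 1 else 0) w.1.1
    exact this
  rw [← h, diff]
  refine Finset.sum_subset Finset.sdiff_subset fun i hi his => ?_
  have his' : i ∈ s := by
    by_contra h; exact his (Finset.mem_sdiff.mpr ⟨hi, h⟩)
  rw [inc_eq_zero_of_not_subset fun h => Finset.notMem_erase i _ (h (ht his')), mul_zero]

end Incidence

/-! ### Exactness in the star of a triangle -/

section Exactness

variable {F : Type*} [Field F] {K : PreAbstractSimplicialComplex ℕ} {s : Finset ℕ}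

theorem sign_insert {t : Finset ℕ} {j : ℕ} (hj : j ∉ t) (i : ℕ) :
    sign (insert j t) i = (if j < i then -1 else 1) * sign t i := by
  rw [sign_erase (Finset.mem_insert_self j t), Finset.erase_insert hj]

/-- `1` if `i < j`, and `-1` otherwise. -/
def orderSign (F : Type*) [Field F] (i j : ℕ) : F := if j < i then -1 else 1

theorem orderSign_mul_self (i j : ℕ) : orderSign F i j * orderSign F i j = 1 := by
  unfold orderSign; split_ifs <;> simp

theorem orderSign_swap {i j : ℕ} (h : i ≠ j) : orderSign F j i = -orderSign F i j := by
  unfold orderSign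
  rcases lt_or_gt_of_ne h with h | h
  · rw [if_pos h, if_neg h.not_gt]
  · rw [if_neg h.not_gt, if_pos h, neg_neg]

theorem intCast_sign_insert {t : Finset ℕ} {j : ℕ} (hj : j ∉ t) (i : ℕ) :
    (sign (insert j t) i : F) = orderSign F i j * sign t i := by
  rw [sign_insert hj, orderSign]
  split_ifs <;> simp

/-- A cochain on simplices containing `s` is, up to signs, a cochain on the link of `s` of degree
lower by `s.card`. Here `φ` becomes a 1-cocycle and `f` its potential. -/
theorem exists_potential (hL : HasTrivialH1 F (link K s)) (φ : Finset ℕ → F)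
    (hφ : ∀ w ∈ K.faces, w.card = s.card + 3 → s ⊆ w →
      ∑ i ∈ w \ s, (sign w i : F) * φ (w.erase i) = 0) :
    ∃ f : Finset ℕ → F, ∀ v ∈ K.faces, v.card = s.card + 2 → s ⊆ v →
      φ v = ∑ i ∈ v \ s, (sign v i : F) * f (v.erase i) := by
  set χ : ℕ → F := fun i => (sign s i : F) with hχ
  have hχ2 : ∀ i, χ i * χ i = 1 := fun i => intCast_sign_mul_self s i
  -- The factors turn the incidence signs of simplices containing `s` into those of the link and
  -- make `c` antisymmetric; the zero diagonal takes care of degenerate triples.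
  set c : ℕ → ℕ → F := fun i j =>
    if i = j then 0 else χ i * χ j * orderSign F i j * φ (insert i (insert j s)) with hc
  obtain ⟨q, hq⟩ := hL c (by
    intro i j k hijk
    obtain ⟨-, hd, hK⟩ := hijk
    by_cases hij : i = j
    · subst hij; simp [hc]
    by_cases hjk : j = k
    · subst hjk; simp [hc]
    by_cases hik : i = k
    · subst hik
      simp only [hc, if_neg hij, if_neg hjk, if_pos, orderSign_swap hij, Finset.insert_comm j i]
      ring
    have his : i ∉ s := Finset.disjoint_left.mp hd (by simp)
    have hjs : j ∉ s := Finset.disjoint_left.mp hd (by simp)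
    have hks : k ∉ s := Finset.disjoint_left.mp hd (by simp)
    have hw : ({i, j, k} : Finset ℕ) ∪ s = insert i (insert j (insert k s)) := by
      simp [Finset.insert_union]
    have hks' : j ∉ insert k s := by simp [hjk, hjs]
    have hi' : i ∉ insert j (insert k s) := by simp [hij, hik, his]
    rw [hw] at hK
    have h := hφ _ hK (by
      rw [Finset.card_insert_of_notMem hi', Finset.card_insert_of_notMem hks',
        Finset.card_insert_of_notMem hks]) (by
      intro x hx; simp [hx])
    have hsd : insert i (insert j (insert k s)) \ s = {i, j, k} := by
      ext x
      simp only [Finset.mem_sdiff, Finset.mem_insert, Finset.mem_singleton]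
      constructor
      · rintro ⟨h1 | h1 | h1 | h1, h2⟩
        · exact Or.inl h1
        · exact Or.inr (Or.inl h1)
        · exact Or.inr (Or.inr h1)
        · exact absurd h1 h2
      · rintro (rfl | rfl | rfl) <;> simp_all
    have ei : (insert i (insert j (insert k s))).erase i = insert j (insert k s) :=
      Finset.erase_insert hi'
    have ej : (insert i (insert j (insert k s))).erase j = insert i (insert k s) := by
      rw [Finset.insert_comm]; exact Finset.erase_insert (by simp [Ne.symm hij, hjk, hjs])
    have ek : (insert i (insert j (insert k s))).erase k = insert i (insert j s) := by
      rw [Finset.insert_comm j k, Finset.insert_comm i k]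
      exact Finset.erase_insert (by simp [Ne.symm hik, Ne.symm hjk, hks])
    have self_sign : ∀ {t : Finset ℕ} {x : ℕ}, x ∉ t → (sign (insert x t) x : F) = sign t x := by
      intro t x hx
      rw [intCast_sign_insert hx, orderSign, if_neg (lt_irrefl x), one_mul]
    have si : (sign (insert i (insert j (insert k s))) i : F) =
        orderSign F i j * (orderSign F i k * χ i) := by
      rw [self_sign hi', intCast_sign_insert hks', intCast_sign_insert hks]
    have sj : (sign (insert i (insert j (insert k s))) j : F) =
        orderSign F j i * (orderSign F j k * χ j) := by
      rw [intCast_sign_insert hi', self_sign hks', intCast_sign_insert hks]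
    have sk : (sign (insert i (insert j (insert k s))) k : F) =
        orderSign F k i * (orderSign F k j * χ k) := by
      rw [intCast_sign_insert hi', intCast_sign_insert hks', self_sign hks]
    rw [hsd, Finset.sum_insert (by simp [hij, hik]), Finset.sum_insert (by simp [hjk]),
      Finset.sum_singleton, ei, ej, ek, si, sj, sk, orderSign_swap hij, orderSign_swap hik,
      orderSign_swap hjk] at h
    simp only [hc, if_neg hij, if_neg hjk, if_neg hik]
    have aij := orderSign_mul_self (F := F) i j
    have aik := orderSign_mul_self (F := F) i k
    have ajk := orderSign_mul_self (F := F) j k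
    have bi := hχ2 i
    have bj := hχ2 j
    have bk := hχ2 k
    generalize orderSign F i j = x at *
    generalize orderSign F i k = y at *
    generalize orderSign F j k = z at *
    generalize χ i = a at *
    generalize χ j = b at *
    generalize χ k = d at *
    have h1 : a * a * (x * x) * (y * y) = 1 := by rw [bi, aij, aik]; ring
    have h2 : b * b * (x * x) * (z * z) = 1 := by rw [bj, aij, ajk]; ring
    have h3 : d * d * (y * y) * (z * z) = 1 := by rw [bk, aik, ajk]; ring
    linear_combination (a * b * d * x * y * z) * h
      - (b * d * z * φ (insert j (insert k s))) * h1
      + (a * d * y * φ (insert i (insert k s))) * h2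
      - (a * b * x * φ (insert i (insert j s))) * h3)
  -- For `t = insert y s` with `y ∉ s` the sum has the single term `χ y * q y`.
  refine ⟨fun t => ∑ y ∈ t \ s, χ y * q y, fun v hv hcard hsv => ?_⟩
  have h2 : (v \ s).card = 2 := by rw [Finset.card_sdiff_of_subset hsv]; omega
  obtain ⟨i, j, hij, hvs⟩ := Finset.card_eq_two.mp h2
  have his : i ∉ s := fun h => (Finset.mem_sdiff.mp (hvs ▸ Finset.mem_insert_self i {j} :
    i ∈ v \ s)).2 h
  have hjs : j ∉ s := fun h => (Finset.mem_sdiff.mp (hvs ▸ (by simp) : j ∈ v \ s)).2 h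
  have hv' : v = insert i (insert j s) := by
    rw [← Finset.sdiff_union_of_subset hsv, hvs]; simp [Finset.insert_union]
  have hjs' : i ∉ insert j s := by simp [hij, his]
  have ei : v.erase i = insert j s := by rw [hv']; exact Finset.erase_insert hjs'
  have ej : v.erase j = insert i s := by
    rw [hv', Finset.insert_comm]; exact Finset.erase_insert (by simp [Ne.symm hij, hjs])
  have si : (sign v i : F) = orderSign F i j * χ i := by
    rw [hv', intCast_sign_insert hjs', orderSign, if_neg (lt_irrefl i), one_mul,
      intCast_sign_insert hjs]
  have sj : (sign v j : F) = orderSign F j i * χ j := by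
    rw [hv', intCast_sign_insert hjs', intCast_sign_insert hjs,
      show orderSign F j j = 1 from if_neg (lt_irrefl j), one_mul]
  have hsd : ∀ {x}, x ∉ s → insert x s \ s = {x} := fun hx => by
    rw [Finset.insert_sdiff_of_notMem _ hx, Finset.sdiff_self]; rfl
  have hl := hq i j ⟨by simp, Finset.disjoint_left.mpr fun x hx => by
    rcases Finset.mem_insert.mp hx with rfl | hx
    · exact his
    · rwa [Finset.mem_singleton.mp hx], by
    rw [← hvs, Finset.sdiff_union_of_subset hsv]; exact hv⟩
  simp only [hc, if_neg hij] at hl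
  rw [hvs, Finset.sum_pair hij]
  dsimp only
  rw [ei, ej, hsd his, hsd hjs, Finset.sum_singleton,
    Finset.sum_singleton, si, sj, orderSign_swap hij, hv']
  have a := orderSign_mul_self (F := F) i j
  have bi := hχ2 i
  have bj := hχ2 j
  generalize orderSign F i j = x at *
  generalize χ i = y at *
  generalize χ j = z at *
  have h1 : (y * y) * (z * z) * (x * x) = 1 := by rw [bi, bj, a]; ring
  linear_combination (x * y * z) * hl - (φ (insert i (insert j s))) * h1

variable [∀ n, Fintype (StarSimplices K s n)]

/-- Homological form of the vanishing of the first cohomology of the link. -/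
theorem exists_chain {n : ℕ} (hs : s.card = n) (hL : HasTrivialH1 F (link K s))
    (c : StarSimplices K s (n + 1) → F)
    (hc : ∀ t : StarSimplices K s n, ∑ v, inc F v.1.1 t.1.1 * c v = 0) :
    ∃ d : StarSimplices K s (n + 2) → F, ∀ v, c v = ∑ w, d w * inc F w.1.1 v.1.1 := by
  classical
  set Λ : StarSimplices K s (n + 2) → (StarSimplices K s (n + 1) → F) →ₗ[F] F :=
    fun w => ∑ v, inc F w.1.1 v.1.1 • LinearMap.proj v with hΛ
  set Γ : (StarSimplices K s (n + 1) → F) →ₗ[F] F := ∑ v, c v • LinearMap.proj v with hΓ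
  -- Duality: a functional lies in the span of finitely many others if it vanishes on their common
  -- kernel. That kernel consists of the 1-cocycles of the link; these are coboundaries, and the
  -- cycle `c` pairs to zero with coboundaries.
  have hmem : Γ ∈ Submodule.span F (Set.range Λ) := by
    refine mem_span_of_iInf_ker_le_ker fun a ha => ?_
    have ha' : ∀ w : StarSimplices K s (n + 2),
        ∑ v : StarSimplices K s (n + 1), inc F w.1.1 v.1.1 * a v = 0 := by
      intro w
      have := LinearMap.mem_ker.mp ((Submodule.mem_iInf _).mp ha w)
      simpa [hΛ] using this
    set φ : Finset ℕ → F := fun t =>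
      if h : (t ∈ K.faces ∧ t.card = n + 1 + 1) ∧ s ⊆ t then a ⟨⟨t, h.1⟩, h.2⟩ else 0 with hφ
    have hφa : ∀ v : StarSimplices K s (n + 1), φ v.1.1 = a v := fun v => dif_pos ⟨v.1.2, v.2⟩
    obtain ⟨f, hf⟩ := exists_potential hL φ (by
      intro w hw hcard hsw
      have h := sum_inc_mul (F := F) (n := n + 1)
        (⟨⟨w, hw, by omega⟩, hsw⟩ : StarSimplices K s (n + 1 + 1)) φ
      rw [← h]
      simp only [hφa]
      exact ha' ⟨⟨w, hw, by omega⟩, hsw⟩)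
    have hav : ∀ v, a v = ∑ t : StarSimplices K s n, inc F v.1.1 t.1.1 * f t.1.1 := by
      intro v
      rw [sum_inc_mul v f, ← hφa]
      exact hf _ v.1.2.1 (by have := v.1.2.2; omega) v.2
    rw [LinearMap.mem_ker]
    have : Γ a = ∑ v, c v * a v := by simp [hΓ]
    rw [this]
    simp only [hav, Finset.mul_sum]
    rw [Finset.sum_comm]
    refine Finset.sum_eq_zero fun t _ => ?_
    have := congrArg (· * f t.1.1) (hc t)
    simp only [zero_mul, Finset.sum_mul] at this
    rw [← this]
    exact Finset.sum_congr rfl fun v _ => by ring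
  obtain ⟨d, hd⟩ := (Submodule.mem_span_range_iff_exists_fun F).mp hmem
  refine ⟨d, fun v => ?_⟩
  have h := LinearMap.congr_fun hd (Pi.single v 1)
  simp only [hΓ, hΛ, LinearMap.sum_apply, LinearMap.smul_apply, LinearMap.proj_apply, smul_eq_mul,
    Pi.single_apply, mul_ite, mul_one, mul_zero, Finset.sum_ite_eq', Finset.mem_univ,
    if_true] at h
  rw [← h]

end Exactness

/-! ### Permitted colorings of the star of a triangle -/

section Star

variable {F : Type*} [Field F] {K : PreAbstractSimplicialComplex ℕ}

/-- The complex formed by the 5-simplices of `K` that contain `s`. -/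
def starComplex (K : PreAbstractSimplicialComplex ℕ) (s : Finset ℕ) :
    PreAbstractSimplicialComplex ℕ where
  faces := {t | t.Nonempty ∧ ∃ w ∈ K.faces, w.card = 6 ∧ s ⊆ w ∧ t ⊆ w}
  isRelLowerSet_faces := fun _ ⟨hne, w, hw, hc, hs, ht⟩ =>
    ⟨hne, fun _ h hne' => ⟨hne', w, hw, hc, hs, h.trans ht⟩⟩

theorem starComplex_le (K : PreAbstractSimplicialComplex ℕ) (s : Finset ℕ) : starComplex K s ≤ K :=
  fun _ ⟨hne, _, hw, _, _, ht⟩ => K.isRelLowerSet_faces.mem_of_le hw ht hne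

theorem erase_mem_face {n : ℕ} (v : Simplices K (n + 1)) {i : ℕ} (hi : i ∈ v.1) :
    v.1.erase i ∈ K.faces ∧ (v.1.erase i).card = n + 1 :=
  (face v ⟨i, hi⟩).2

/-- If a coloring is given by a cocycle on a 5-simplex, this cocycle is determined on each 4-face
by the color, up to a multiple of `ω`. -/
theorem exists_zeroExt_eq {ω : Param K F} (r : Coloring ω) {w : Finset ℕ} (hw : w ∈ K.faces)
    {ν : Cocycles (simplex w) 3 F}
    (hν : r.restrict (simplex_le hw) = coloringOf (ω.restrict (simplex_le hw)) ν)
    (v : Simplices K 4) (hv : v.1 ⊆ w) : ∃ κ : F, ∀ i ∈ v.1, zeroExt ν.1 (v.1.erase i) =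
      zeroExt (Quotient.out (r v)).1 (v.1.erase i) + κ * zeroExt ω.1.1 (v.1.erase i) := by
  have hvw : v.1 ∈ (simplex w).faces := ⟨face_nonempty v.2.1, hv⟩
  have h1 : r v = Submodule.Quotient.mk (restrict 3 F (simplex_mono hv) ν) :=
    congrFun hν ⟨v.1, hvw, v.2.2⟩
  have h2 : Submodule.Quotient.mk (Quotient.out (r v)) = r v := Quotient.out_eq (r v)
  have h3 := h1.symm.trans h2.symm
  rw [Submodule.Quotient.eq, Submodule.mem_span_singleton] at h3
  obtain ⟨κ, hκ⟩ := h3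
  refine ⟨κ, fun i hi => ?_⟩
  have ht := erase_mem_face v hi
  have hne := face_nonempty ht.1
  have e1 := zeroExt_apply ν.1 ⟨v.1.erase i, ⟨hne, (Finset.erase_subset _ _).trans hv⟩, ht.2⟩
  have e2 := zeroExt_apply (Quotient.out (r v)).1
    ⟨v.1.erase i, ⟨hne, Finset.erase_subset _ _⟩, ht.2⟩
  have e3 := zeroExt_apply ω.1.1 ⟨v.1.erase i, ht⟩
  dsimp only at e1 e2 e3
  rw [e1, e2, e3]
  have := congrArg (fun z => z.1 ⟨v.1.erase i, ⟨hne, Finset.erase_subset _ _⟩, ht.2⟩) hκ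
  exact eq_add_of_sub_eq' this.symm

theorem coloringOf_add_smul (ω : Param K F) (ν : Cocycles K 3 F) (κ : F) :
    coloringOf ω (ν + κ • ω.1) = coloringOf ω ν := by
  funext v
  refine (Submodule.Quotient.eq _).mpr (Submodule.mem_span_singleton.mpr ⟨κ, ?_⟩)
  exact (add_sub_cancel_left (restrict 3 F (simplex_le v.2.1) ν) _).symm

/-- The link of `v` is a 0-sphere, so two distinct cofaces are all the cofaces. -/
theorem exists_two_cofaces (hK : IsClosedPLManifold 5 K) (v : Simplices K 4) {w w' : Finset ℕ}
    (hw : w ∈ K.faces) (hw' : w' ∈ K.faces) (hc : w.card = 6) (hc' : w'.card = 6)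
    (hv : v.1 ⊆ w) (hv' : v.1 ⊆ w') (hne : w ≠ w') :
    ∀ u ∈ K.faces, u.card = 6 → v.1 ⊆ u → u = w ∨ u = w' := by
  obtain ⟨x, y, -, hxy⟩ := hK.isTwoPoints_link v.2.1 v.2.2
  have key : ∀ u ∈ K.faces, u.card = 6 → v.1 ⊆ u → u = insert x v.1 ∨ u = insert y v.1 := by
    intro u hu huc hvu
    have h1 : (u \ v.1).card = 1 := by
      rw [Finset.card_sdiff_of_subset hvu, huc, v.2.2]
    have h2 : u \ v.1 ∈ (link K v.1).faces :=
      ⟨Finset.card_pos.mp (by omega), Finset.sdiff_disjoint, by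
        rwa [Finset.sdiff_union_of_subset hvu]⟩
    have h3 := Finset.sdiff_union_of_subset hvu
    rcases (hxy _).mp h2 with h | h <;> rw [h] at h3
    · exact Or.inl h3.symm
    · exact Or.inr h3.symm
  intro u hu huc hvu
  rcases key u hu huc hvu with h | h <;> rcases key w hw hc hv with h1 | h1 <;>
    rcases key w' hw' hc' hv' with h2 | h2
  all_goals first
    | exact Or.inl (h.trans h1.symm)
    | exact Or.inr (h.trans h2.symm)
    | exact absurd (h1.trans h2.symm) hne

variable {s : Finset ℕ} [∀ n, Fintype (StarSimplices K s n)]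

/-- Representatives on 5-simplices are free up to multiples of `ω`; the obstruction to matching them
across 4-simplices containing `s` is a 1-cycle in the link of `s`. -/
theorem exists_compatible_representatives (hK : IsClosedPLManifold 5 K) (hs : s ∈ K.faces)
    (hsc : s.card = 3) (o : Simplices K 5 → F) (ho1 : ∀ w, o w * o w = 1)
    (ho : ∀ v : StarSimplices K s 4, ∑ w : StarSimplices K s 5, o w.1 * inc F w.1.1 v.1.1 = 0)
    {ω : Param K F} (ρ : Permitted ω) :
    ∃ ν : (w : StarSimplices K s 5) → Cocycles (simplex w.1.1) 3 F,
      (∀ w, ρ.1.restrict (simplex_le w.1.2.1) =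
        coloringOf (ω.restrict (simplex_le w.1.2.1)) (ν w)) ∧
      ∀ (v : StarSimplices K s 4) (w w' : StarSimplices K s 5), v.1.1 ⊆ w.1.1 → v.1.1 ⊆ w'.1.1 →
        ∀ i ∈ v.1.1, zeroExt (ν w).1 (v.1.1.erase i) = zeroExt (ν w').1 (v.1.1.erase i) := by
  choose ν₀ hν₀ using ρ.2
  set N : StarSimplices K s 5 → Finset ℕ → F := fun w => zeroExt (ν₀ w.1).1 with hN
  set W : Finset ℕ → F := zeroExt ω.1.1 with hW
  set Q : StarSimplices K s 4 → Finset ℕ → F := fun v => zeroExt (Quotient.out (ρ.1 v.1)).1 with hQ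
  have hκ : ∀ (w : StarSimplices K s 5) (v : StarSimplices K s 4), ∃ κ : F, v.1.1 ⊆ w.1.1 →
      ∀ i ∈ v.1.1, N w (v.1.1.erase i) = Q v (v.1.1.erase i) + κ * W (v.1.1.erase i) := by
    intro w v
    by_cases h : v.1.1 ⊆ w.1.1
    · obtain ⟨κ, hκ⟩ := exists_zeroExt_eq ρ.1 w.1.2.1 (hν₀ w.1) v.1 h
      exact ⟨κ, fun _ => hκ⟩
    · exact ⟨0, fun h' => absurd h' h⟩
  choose κ hκ using hκ
  -- Up to sign, `c v` is the difference of the coefficients `κ` from the two sides of `v`.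
  set c : StarSimplices K s 4 → F := fun v =>
    ∑ w : StarSimplices K s 5, o w.1 * inc F w.1.1 v.1.1 * κ w v with hc
  have hcW : ∀ (v : StarSimplices K s 4), ∀ i ∈ v.1.1,
      ∑ w : StarSimplices K s 5, o w.1 * inc F w.1.1 v.1.1 * N w (v.1.1.erase i) =
        c v * W (v.1.1.erase i) := by
    intro v i hi
    have h1 : ∀ w : StarSimplices K s 5, o w.1 * inc F w.1.1 v.1.1 * N w (v.1.1.erase i) =
        o w.1 * inc F w.1.1 v.1.1 * Q v (v.1.1.erase i) +
          o w.1 * inc F w.1.1 v.1.1 * κ w v * W (v.1.1.erase i) := by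
      intro w
      by_cases h : v.1.1 ⊆ w.1.1
      · rw [hκ w v h i hi]; ring
      · rw [inc_eq_zero_of_not_subset h]; ring
    rw [Finset.sum_congr rfl fun w _ => h1 w, Finset.sum_add_distrib, ← Finset.sum_mul, ho v,
      zero_mul, zero_add, ← Finset.sum_mul]
  -- Multiplied by `W t`, the boundary of `c` at `t` becomes a sum of `N w t` against the boundary
  -- of the boundary of `w`. Since `ω` does not vanish at `t`, this factor can be cancelled.
  have hcycle : ∀ t : StarSimplices K s 3, ∑ v, inc F v.1.1 t.1.1 * c v = 0 := by
    intro t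
    have hWt : W t.1.1 ≠ 0 := by
      rw [hW, zeroExt_apply]; exact ω.2 t.1
    refine (mul_eq_zero.mp ?_).resolve_right hWt
    have h1 : ∀ v : StarSimplices K s 4, inc F v.1.1 t.1.1 * c v * W t.1.1 =
        ∑ w : StarSimplices K s 5, o w.1 * N w t.1.1 * (inc F w.1.1 v.1.1 * inc F v.1.1 t.1.1) := by
      intro v
      by_cases h : inc F v.1.1 t.1.1 = 0
      · simp [h]
      · obtain ⟨i, hi, hti⟩ := inc_ne_zero h
        have h2 := hcW v i hi
        rw [← hti] at h2
        rw [mul_assoc, ← h2, Finset.mul_sum]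
        exact Finset.sum_congr rfl fun w _ => by ring
    rw [Finset.sum_mul, Finset.sum_congr rfl fun v _ => h1 v, Finset.sum_comm]
    refine Finset.sum_eq_zero fun w _ => ?_
    rw [← Finset.mul_sum, sum_inc_mul_inc w t.2, mul_zero]
  obtain ⟨d, hd⟩ := exists_chain hsc (hK.hasTrivialH1_link hs (by omega)) c hcycle
  -- With `c = ∂d`, subtracting `o w * d w` times `ω` removes the discrepancy at every `v`; here `o
  -- w * o w = 1` is used.
  set ν : (w : StarSimplices K s 5) → Cocycles (simplex w.1.1) 3 F := fun w =>
    ν₀ w.1 + (-(o w.1 * d w)) • (ω.restrict (simplex_le w.1.2.1)).1 with hν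
  refine ⟨ν, fun w => ?_, ?_⟩
  · rw [hν, coloringOf_add_smul]; exact hν₀ w.1
  intro v w w' hvw hvw' i hi
  have ht := erase_mem_face v.1 hi
  have hval : ∀ u : StarSimplices K s 5, v.1.1 ⊆ u.1.1 →
      zeroExt (ν u).1 (v.1.1.erase i) =
        N u (v.1.1.erase i) - o u.1 * d u * W (v.1.1.erase i) := by
    intro u hu
    have htu : v.1.1.erase i ∈ (simplex u.1.1).faces :=
      ⟨face_nonempty ht.1, (Finset.erase_subset _ _).trans hu⟩
    have e1 := zeroExt_apply (ν u).1 ⟨v.1.1.erase i, htu, ht.2⟩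
    have e2 := zeroExt_apply (ν₀ u.1).1 ⟨v.1.1.erase i, htu, ht.2⟩
    have e3 := zeroExt_apply ω.1.1 ⟨v.1.1.erase i, ht⟩
    dsimp only at e1 e2 e3
    refine e1.trans ?_
    change _ = zeroExt (ν₀ u.1).1 _ - o u.1 * d u * zeroExt ω.1.1 _
    rw [e2, e3, sub_eq_add_neg, ← neg_mul]
    rfl
  have hzero : ∑ u : StarSimplices K s 5, o u.1 * inc F u.1.1 v.1.1 *
      zeroExt (ν u).1 (v.1.1.erase i) = 0 := by
    have h1 : ∀ u : StarSimplices K s 5, o u.1 * inc F u.1.1 v.1.1 *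
        zeroExt (ν u).1 (v.1.1.erase i) =
        o u.1 * inc F u.1.1 v.1.1 * N u (v.1.1.erase i) -
          d u * inc F u.1.1 v.1.1 * W (v.1.1.erase i) := by
      intro u
      by_cases h : v.1.1 ⊆ u.1.1
      · rw [hval u h]
        linear_combination (-(d u * inc F u.1.1 v.1.1 * W (v.1.1.erase i))) * ho1 u.1
      · rw [inc_eq_zero_of_not_subset h]; ring
    rw [Finset.sum_congr rfl fun u _ => h1 u, Finset.sum_sub_distrib, hcW v i hi, hd v,
      Finset.sum_mul, sub_self]
  by_cases hww : w = w'
  · rw [hww]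
  have hww' : w.1.1 ≠ w'.1.1 := fun e => hww (Subtype.ext (Subtype.ext e))
  have hinc0 : ∀ u : StarSimplices K s 5, u ≠ w ∧ u ≠ w' → inc F u.1.1 v.1.1 = 0 := by
    rintro u ⟨h1, h2⟩
    refine inc_eq_zero_of_not_subset fun h => ?_
    rcases exists_two_cofaces hK v.1 w.1.2.1 w'.1.2.1 w.1.2.2 w'.1.2.2 hvw hvw' hww' u.1.1
      u.1.2.1 u.1.2.2 h with e | e
    · exact h1 (Subtype.ext (Subtype.ext e))
    · exact h2 (Subtype.ext (Subtype.ext e))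
  -- Only `w` and `w'` contribute to either sum, with opposite coefficients, so the weighted sum of
  -- the values being zero means that the two values are equal.
  have s1 := ho v
  rw [Fintype.sum_eq_add w w' hww fun u hu => by rw [hinc0 u hu, mul_zero]] at s1
  rw [Fintype.sum_eq_add w w' hww fun u hu => by rw [hinc0 u hu, mul_zero, zero_mul]] at hzero
  have hne : o w.1 * inc F w.1.1 v.1.1 ≠ 0 := by
    refine mul_ne_zero (left_ne_zero_of_mul_eq_one (ho1 w.1)) ?_
    have h1 : (w.1.1 \ v.1.1).card = 1 := by
      rw [Finset.card_sdiff_of_subset hvw, w.1.2.2, v.1.2.2]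
    obtain ⟨z, hz⟩ := Finset.card_eq_one.mp h1
    have hzw : z ∈ w.1.1 :=
      (Finset.mem_sdiff.mp (hz ▸ Finset.mem_singleton_self z : z ∈ w.1.1 \ v.1.1)).1
    have hvz : v.1.1 = w.1.1.erase z := by
      rw [← Finset.sdiff_singleton_eq_erase, ← hz, Finset.sdiff_sdiff_eq_self hvw]
    rw [hvz, inc_erase hzw]
    exact intCast_sign_ne_zero _ _
  refine mul_left_cancel₀ hne ?_
  linear_combination hzero - zeroExt (ν w').1 (v.1.1.erase i) * s1

/-- In the star of a triangle, a permitted coloring is given by a cocycle. -/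
theorem exists_cocycle_on_star (hK : IsClosedPLManifold 5 K) (hs : s ∈ K.faces)
    (hsc : s.card = 3) (o : Simplices K 5 → F) (ho1 : ∀ w, o w * o w = 1)
    (ho : ∀ v : StarSimplices K s 4, ∑ w : StarSimplices K s 5, o w.1 * inc F w.1.1 v.1.1 = 0)
    {ω : Param K F} (ρ : Permitted ω) :
    ∃ ν : Cocycles (starComplex K s) 3 F, ρ.1.restrict (starComplex_le K s) =
      coloringOf (ω.restrict (starComplex_le K s)) ν := by
  obtain ⟨ν, hν, hcomp⟩ := exists_compatible_representatives hK hs hsc o ho1 ho ρ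
  have consistent : ∀ (t : Simplices K 3) (w w' : StarSimplices K s 5), t.1 ⊆ w.1.1 →
      t.1 ⊆ w'.1.1 → zeroExt (ν w).1 t.1 = zeroExt (ν w').1 t.1 := by
    intro t w w' htw htw'
    have hsub : t.1 ∪ s ⊆ w.1.1 := Finset.union_subset htw w.2
    have hsub' : t.1 ∪ s ⊆ w'.1.1 := Finset.union_subset htw' w'.2
    have hle : (t.1 ∪ s).card ≤ 6 := (Finset.card_le_card hsub).trans w.1.2.2.le
    have hge : 4 ≤ (t.1 ∪ s).card :=
      t.2.2.symm.le.trans (Finset.card_le_card Finset.subset_union_left)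
    have hface : t.1 ∪ s ∈ K.faces :=
      face_mono w.1.2.1 hsub ((face_nonempty t.2.1).mono Finset.subset_union_left)
    have hpair : ∀ (y : ℕ) (u u' : StarSimplices K s 5), y ∉ t.1 → s ⊆ insert y t.1 →
        insert y t.1 ⊆ u.1.1 → insert y t.1 ⊆ u'.1.1 →
        zeroExt (ν u).1 t.1 = zeroExt (ν u').1 t.1 := by
      intro y u u' hy hsy hu hu'
      have := hcomp ⟨⟨insert y t.1, face_mono u.1.2.1 hu (by simp), by
        rw [Finset.card_insert_of_notMem hy, t.2.2]⟩, hsy⟩ u u' hu hu' y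
          (Finset.mem_insert_self _ _)
      simpa only [Finset.erase_insert hy] using this
    -- If `t ∪ s` has 6 vertices, it is both `w` and `w'`. If it has 5, it is a 4-simplex containing
    -- `s` and common to both. If it has 4, then `s ⊆ t`, and `w`, `w'` need not share a 4-simplex.
    rcases (by omega : (t.1 ∪ s).card = 6 ∨ (t.1 ∪ s).card = 5 ∨ (t.1 ∪ s).card = 4) with h | h | h
    · have e1 := Finset.eq_of_subset_of_card_le hsub (by rw [h, w.1.2.2])
      have e2 := Finset.eq_of_subset_of_card_le hsub' (by rw [h, w'.1.2.2])
      have : w = w' := Subtype.ext (Subtype.ext (e1.symm.trans e2))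
      rw [this]
    · have h1 : ((t.1 ∪ s) \ t.1).card = 1 := by
        rw [Finset.card_sdiff_of_subset Finset.subset_union_left, h, t.2.2]
      obtain ⟨y, hy⟩ := Finset.card_eq_one.mp h1
      have hyt : y ∉ t.1 := (Finset.mem_sdiff.mp
        (hy ▸ Finset.mem_singleton_self y : y ∈ (t.1 ∪ s) \ t.1)).2
      have e : t.1 ∪ s = insert y t.1 := by
        rw [← Finset.sdiff_union_of_subset (Finset.subset_union_left : t.1 ⊆ t.1 ∪ s), hy]; rfl
      rw [e] at hsub hsub'
      exact hpair y w w' hyt (e ▸ Finset.subset_union_right) hsub hsub'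
    · have e : t.1 = t.1 ∪ s := Finset.eq_of_subset_of_card_le Finset.subset_union_left
        (by rw [h, t.2.2])
      have hst : s ⊆ t.1 := by rw [e]; exact Finset.subset_union_right
      classical
      -- The link of `t` is a circle. A vertex `y` of it gives a 4-simplex, on whose cofaces the
      -- value at `t` is the same; an edge is a 5-simplex linking two such vertices. Hence `f` is
      -- constant around the circle.
      set f : ℕ → F := fun y => if hy : ∃ u : StarSimplices K s 5, insert y t.1 ⊆ u.1.1 then
        zeroExt (ν hy.choose).1 t.1 else 0 with hf
      have hfu : ∀ (y : ℕ) (u : StarSimplices K s 5), y ∉ t.1 → insert y t.1 ⊆ u.1.1 →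
          f y = zeroExt (ν u).1 t.1 := by
        intro y u hy hu
        have hex : ∃ u : StarSimplices K s 5, insert y t.1 ⊆ u.1.1 := ⟨u, hu⟩
        rw [hf]
        dsimp only
        rw [dif_pos hex]
        exact hpair y _ u hy (hst.trans (Finset.subset_insert _ _)) hex.choose_spec hu
      have hconn := hK.isEdgeConnected_link (F := F) t.2.1 (by rw [t.2.2]) f (by
        intro i j hij
        obtain ⟨-, hd, hij⟩ := hij
        by_cases hne : i = j
        · rw [hne]
        have hi : i ∉ t.1 := Finset.disjoint_left.mp hd (by simp)
        have hj : j ∉ t.1 := Finset.disjoint_left.mp hd (by simp)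
        let u : StarSimplices K s 5 := ⟨⟨{i, j} ∪ t.1, hij, by
          rw [Finset.card_union_of_disjoint hd, Finset.card_pair hne, t.2.2]⟩,
          hst.trans Finset.subset_union_right⟩
        rw [hfu i u hi (Finset.insert_subset (by simp [u]) Finset.subset_union_right),
          hfu j u hj (Finset.insert_subset (by simp [u]) Finset.subset_union_right)])
      have hvert : ∀ u : StarSimplices K s 5, t.1 ⊆ u.1.1 → ∃ y, {y} ∈ (link K t.1).faces ∧
          f y = zeroExt (ν u).1 t.1 := by
        intro u hu
        have h1 : (u.1.1 \ t.1).Nonempty := by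
          rw [← Finset.card_pos, Finset.card_sdiff_of_subset hu, u.1.2.2, t.2.2]; norm_num
        obtain ⟨y, hy⟩ := h1
        obtain ⟨hyu, hyt⟩ := Finset.mem_sdiff.mp hy
        have hins : insert y t.1 ⊆ u.1.1 := Finset.insert_subset hyu hu
        exact ⟨y, ⟨by simp, by simpa using hyt, face_mono u.1.2.1 hins (by simp)⟩,
          hfu y u hyt hins⟩
      obtain ⟨y, hy, ey⟩ := hvert w htw
      obtain ⟨y', hy', ey'⟩ := hvert w' htw'
      rw [← ey, ← ey']
      exact hconn y y' hy hy'
  have hex : ∀ t : Simplices (starComplex K s) 3, ∃ w : StarSimplices K s 5, t.1 ⊆ w.1.1 := by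
    rintro ⟨t, ⟨-, w, hw, hc, hsw, htw⟩, -⟩
    exact ⟨⟨⟨w, hw, hc⟩, hsw⟩, htw⟩
  choose τ hτ using hex
  set μ : Cochain (starComplex K s) 3 F := fun t => zeroExt (ν (τ t)).1 t.1 with hμ
  have hμw : ∀ (t : Simplices (starComplex K s) 3) (w : StarSimplices K s 5), t.1 ⊆ w.1.1 →
      μ t = zeroExt (ν w).1 t.1 := fun t w htw =>
    consistent ⟨t.1, starComplex_le K s t.2.1, t.2.2⟩ _ _ (hτ t) htw
  have hface : ∀ (v : Simplices (starComplex K s) 4) (w : StarSimplices K s 5), v.1 ⊆ w.1.1 →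
      ∀ i ∈ v.1, zeroExt μ (v.1.erase i) = zeroExt (ν w).1 (v.1.erase i) := by
    intro v w hvw i hi
    have e := zeroExt_apply μ ⟨v.1.erase i, erase_mem_face v hi⟩
    exact e.trans (hμw _ w ((Finset.erase_subset _ _).trans hvw))
  have hμc : μ ∈ Cocycles (starComplex K s) 3 F := by
    refine LinearMap.mem_ker.mpr (funext fun v => ?_)
    obtain ⟨hne, w, hw, hc, hsw, hvw⟩ := v.2.1
    rw [coboundary_eq_diff_zeroExt, diff_congr (hface v ⟨⟨w, hw, hc⟩, hsw⟩ hvw)]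
    exact diff_zeroExt_of_mem_cocycles (ν ⟨⟨w, hw, hc⟩, hsw⟩) ⟨v.1, ⟨hne, hvw⟩, v.2.2⟩
  refine ⟨⟨μ, hμc⟩, funext fun v => ?_⟩
  obtain ⟨hne, w, hw, hc, hsw, hvw⟩ := v.2.1
  have h1 := congrFun (hν ⟨⟨w, hw, hc⟩, hsw⟩) ⟨v.1, ⟨hne, hvw⟩, v.2.2⟩
  refine Eq.trans h1 ?_
  have h2 : restrict 3 F (simplex_mono hvw) (ν ⟨⟨w, hw, hc⟩, hsw⟩) =
      restrict 3 F (simplex_le v.2.1) (⟨μ, hμc⟩ : Cocycles (starComplex K s) 3 F) := by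
    refine Subtype.ext (funext fun t => ?_)
    have e1 := zeroExt_apply (ν ⟨⟨w, hw, hc⟩, hsw⟩).1
      ⟨t.1, ⟨t.2.1.1, t.2.1.2.trans hvw⟩, t.2.2⟩
    have e2 := hμw ⟨t.1, simplex_le v.2.1 t.2.1, t.2.2⟩ ⟨⟨w, hw, hc⟩, hsw⟩ (t.2.1.2.trans hvw)
    exact e1.symm.trans e2.symm
  exact congrArg (Submodule.Quotient.mk) h2

end Star

/-! ### Extension to the cone over a star -/

section Cone

variable {F : Type*} [Field F] {K : PreAbstractSimplicialComplex ℕ}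

/-- The cone with apex `x` over `starComplex K s`. -/
def coneComplex (K : PreAbstractSimplicialComplex ℕ) (s : Finset ℕ) (x : ℕ) :
    PreAbstractSimplicialComplex ℕ where
  faces := {t | t.Nonempty ∧ ∃ w ∈ K.faces, w.card = 6 ∧ s ⊆ w ∧ t ⊆ insert x w}
  isRelLowerSet_faces := fun _ ⟨hne, w, hw, hc, hs, ht⟩ =>
    ⟨hne, fun _ h hne' => ⟨hne', w, hw, hc, hs, h.trans ht⟩⟩

theorem starComplex_le_coneComplex (K : PreAbstractSimplicialComplex ℕ) (s : Finset ℕ) (x : ℕ) :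
    starComplex K s ≤ coneComplex K s x :=
  fun _ ⟨hne, w, hw, hc, hs, ht⟩ => ⟨hne, w, hw, hc, hs, ht.trans (Finset.subset_insert _ _)⟩

theorem finite_faces_coneComplex (hK : K.faces.Finite) (s : Finset ℕ) (x : ℕ) :
    (coneComplex K s x).faces.Finite := by
  refine (hK.biUnion fun w _ => (insert x w).powerset.finite_toSet).subset ?_
  rintro t ⟨-, w, hw, -, -, ht⟩
  exact Set.mem_biUnion hw (Finset.mem_coe.mpr (Finset.mem_powerset.mpr ht))

theorem finite_simplices (hK : K.faces.Finite) (n : ℕ) : Finite (Simplices K n) :=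
  Set.Finite.to_subtype (hK.subset fun _ h => h.1)

/-- The coboundary of a cochain, as a cocycle. -/
def coboundaryCocycle {n : ℕ} (β : Cochain K n F) : Cocycles K (n + 1) F :=
  ⟨coboundary K n F β, LinearMap.mem_ker.mpr (coboundary_coboundary β)⟩

/-- The star of `s` is a cone from any vertex of `s`, so `ν = δγ`; extending `γ` by zero and taking
`δ` extends `ν`. -/
theorem exists_cocycle_extension {s : Finset ℕ} (hs : s.Nonempty) (x : ℕ) {n : ℕ}
    (ν : Cocycles (starComplex K s) (n + 1) F) :
    ∃ ν' : Cocycles (coneComplex K s x) (n + 1) F,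
      restrict (n + 1) F (starComplex_le_coneComplex K s x) ν' = ν := by
  obtain ⟨a, ha⟩ := hs
  obtain ⟨γ, hγ⟩ := exists_coboundary_eq (K := starComplex K s) (a := a)
    (fun t ⟨_, w, hw, hc, hs, ht⟩ => ⟨Finset.insert_nonempty _ _, w, hw, hc, hs,
      Finset.insert_subset (hs ha) ht⟩) ν
  refine ⟨coboundaryCocycle fun t => zeroExt γ t.1, Subtype.ext (funext fun t => ?_)⟩
  rw [← hγ, coboundary_eq_diff_zeroExt]
  exact coboundary_eq_diff _ (zeroExt γ) (fun _ => rfl)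
    ⟨t.1, starComplex_le_coneComplex K s x t.2.1, t.2.2⟩

/-- Over an infinite field, finitely many nonzero affine functions have a common point where none
of them vanishes. -/
theorem exists_forall_ne [Infinite F] {V ι : Type*} [AddCommGroup V] [Module F V] (S : Finset ι)
    (l : ι → V →ₗ[F] F) (c : ι → F) (hl : ∀ i ∈ S, l i ≠ 0) : ∃ v, ∀ i ∈ S, l i v ≠ c i := by
  classical
  induction S using Finset.induction_on with
  | empty => exact ⟨0, by simp⟩
  | insert i S hi ih =>
    obtain ⟨v, hv⟩ := ih fun j hj => hl j (Finset.mem_insert_of_mem hj)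
    obtain ⟨u, hu⟩ : ∃ u, l i u ≠ 0 := by
      by_contra! h
      exact hl i (Finset.mem_insert_self i S) (LinearMap.ext h)
    -- Along the line `v + r u`, a function that is nonconstant there excludes one `r`; one that is
    -- constant keeps its admissible value at `v`, and `i` is not among these.
    obtain ⟨r, hr⟩ := Infinite.exists_notMem_finset
      ((insert i S).image fun j => (c j - l j v) / l j u)
    refine ⟨v + r • u, fun j hj h => ?_⟩
    rw [map_add, map_smul, smul_eq_mul] at h
    by_cases hj0 : l j u = 0
    · rw [hj0, mul_zero, add_zero] at h
      rcases Finset.mem_insert.mp hj with rfl | hj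
      · exact hu hj0
      · exact hv j hj h
    · refine hr (Finset.mem_image.mpr ⟨j, hj, ?_⟩)
      rw [div_eq_iff hj0, ← h]; ring

/-- An arbitrary extension is corrected by the coboundary of a generic 2-cochain supported on
triangles through `x`. This leaves the tetrahedra without `x` unchanged and moves every tetrahedron
with `x` away from zero. -/
theorem exists_param_extension [Infinite F] (hK : K.faces.Finite) {s : Finset ℕ}
    (hs : s.Nonempty) {x : ℕ} (hx : ∀ t ∈ K.faces, x ∉ t) (ω : Param (starComplex K s) F) :
    ∃ ω' : Param (coneComplex K s x) F, ω'.restrict (starComplex_le_coneComplex K s x) = ω := by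
  obtain ⟨ν, hν⟩ := exists_cocycle_extension hs x ω.1
  have := finite_simplices (finite_faces_coneComplex hK s x) 3
  have := Fintype.ofFinite (Simplices (coneComplex K s x) 3)
  classical
  set l : Simplices (coneComplex K s x) 3 → (Finset ℕ → F) →ₗ[F] F := fun t =>
    ∑ i ∈ t.1, if x ∈ t.1.erase i then (sign t.1 i : F) • LinearMap.proj (t.1.erase i) else 0
    with hl
  have hlapp : ∀ t e, l t e = diff (fun u => if x ∈ u then e u else 0) t.1 := by
    intro t e
    rw [hl, diff, LinearMap.sum_apply]
    refine Finset.sum_congr rfl fun i _ => ?_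
    split_ifs <;> simp
  -- The functional of a tetrahedron `t ∋ x` is nonzero: on the indicator of a face that contains
  -- `x` it takes the value `±1`.
  obtain ⟨e, he⟩ := exists_forall_ne (Finset.univ.filter fun t => x ∈ t.1) l (fun t => -ν.1 t) (by
    intro t ht h0
    have hxt : x ∈ t.1 := (Finset.mem_filter.mp ht).2
    obtain ⟨i, hi⟩ : (t.1.erase x).Nonempty := by
      rw [← Finset.card_pos, Finset.card_erase_of_mem hxt, t.2.2]; norm_num
    obtain ⟨hix, hit⟩ := Finset.mem_erase.mp hi
    have h1 := hlapp t (fun u => if u = t.1.erase i then 1 else 0)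
    rw [h0, LinearMap.zero_apply] at h1
    refine intCast_sign_ne_zero (F := F) t.1 i ?_
    rw [← inc_erase hit, h1, inc]
    refine diff_congr fun j _ => ?_
    by_cases h2 : t.1.erase j = t.1.erase i
    · rw [h2, if_pos rfl, if_pos (Finset.mem_erase.mpr ⟨Ne.symm hix, hxt⟩)]
    · rw [if_neg h2, ite_self])
  set η : Cochain (coneComplex K s x) 2 F := fun u => if x ∈ u.1 then e u.1 else 0 with hη
  have hηt : ∀ t, coboundary _ 2 F η t = l t e := fun t => by
    rw [hlapp]
    exact coboundary_eq_diff η (fun u => if x ∈ u then e u else 0) (fun _ => rfl) t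
  have hnot : ∀ t : Simplices (coneComplex K s x) 3, x ∉ t.1 → l t e = 0 := by
    intro t hxt
    rw [hlapp, diff]
    refine Finset.sum_eq_zero fun i _ => ?_
    rw [if_neg fun h => hxt (Finset.mem_of_mem_erase h), mul_zero]
  refine ⟨⟨ν + coboundaryCocycle η, fun t => ?_⟩, Subtype.ext ?_⟩
  · change ν.1 t + coboundary _ 2 F η t ≠ 0
    rw [hηt]
    by_cases hxt : x ∈ t.1
    · intro h
      exact he t (Finset.mem_filter.mpr ⟨Finset.mem_univ _, hxt⟩) (eq_neg_of_add_eq_zero_right h)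
    · rw [hnot t hxt, add_zero]
      obtain ⟨hne, w, hw, hc, hsw, ht⟩ := t.2.1
      have ht' : t.1 ∈ (starComplex K s).faces :=
        ⟨hne, w, hw, hc, hsw, (Finset.subset_insert_iff_of_notMem hxt).mp ht⟩
      have h1 := congrArg (fun z => z.1 ⟨t.1, ht', t.2.2⟩) hν
      have h2 : ν.1 t = ω.1.1 ⟨t.1, ht', t.2.2⟩ := h1
      rw [h2]
      exact ω.2 _
  · refine Eq.trans ?_ hν
    refine Subtype.ext (funext fun t => ?_)
    have hxt : x ∉ t.1 := hx t.1 (starComplex_le K s t.2.1)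
    change ν.1 ⟨t.1, _⟩ + coboundary _ 2 F η ⟨t.1, _⟩ = ν.1 ⟨t.1, _⟩
    rw [hηt, hnot _ hxt, add_zero]

end Cone

/-! ### Values of a 5-cochain on colorings -/

section Value

variable {F : Type*} [Field F] {K : PreAbstractSimplicialComplex ℕ}

/-- The simplicial 5-cochain formed by the values of `c` on a pair of permitted colorings. -/
def FiveCochain.value (c : FiveCochain F) {ω : Param K F} (r₁ r₂ : Permitted ω) : Cochain K 5 F :=
  fun w => c w.1 w.2.2 (ω.restrict (simplex_le w.2.1)) (restrictPermitted r₁ (simplex_le w.2.1))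
    (restrictPermitted r₂ (simplex_le w.2.1))

theorem FiveCochain.IsCocycle.coboundary_value {c : FiveCochain F} (hc : c.IsCocycle)
    {ω : Param K F} (r₁ r₂ : Permitted ω) : coboundary K 5 F (c.value r₁ r₂) = 0 := by
  funext u
  exact hc u.1 u.2.2 (ω.restrict (simplex_le u.2.1)) (restrictPermitted r₁ (simplex_le u.2.1))
    (restrictPermitted r₂ (simplex_le u.2.1))

/-- The types of the colorings depend on the parameter, so colorings for equal parameters are
compared through common cocycles that give them. -/
theorem FiveCochain.congr (c : FiveCochain F) {w : Finset ℕ} (hw : w.card = 6)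
    {ω ω' : Param (simplex w) F} (hω : ω = ω') {r₁ r₂ : Permitted ω} {r₁' r₂' : Permitted ω'}
    (ν η : Cocycles (simplex w) 3 F) (h₁ : r₁.1 = coloringOf ω ν) (h₁' : r₁'.1 = coloringOf ω' ν)
    (h₂ : r₂.1 = coloringOf ω η) (h₂' : r₂'.1 = coloringOf ω' η) :
    c w hw ω r₁ r₂ = c w hw ω' r₁' r₂' := by
  subst hω
  rw [Subtype.ext (h₁.trans h₁'.symm), Subtype.ext (h₂.trans h₂'.symm)]

/-- The permitted coloring given by a global cocycle. -/
def toPermitted (ω : Param K F) (ν : Cocycles K 3 F) : Permitted ω :=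
  ⟨coloringOf ω ν, fun w => ⟨restrict 3 F (simplex_le w.2.1) ν, rfl⟩⟩

theorem restrict_eq_coloringOf {L M : PreAbstractSimplicialComplex ℕ} {ω : Param K F}
    {r : Coloring ω} (h : L ≤ K) (h' : M ≤ L) {ν : Cocycles L 3 F}
    (hr : r.restrict h = coloringOf (ω.restrict h) ν) :
    r.restrict (h'.trans h) = coloringOf (ω.restrict (h'.trans h)) (restrict 3 F h' ν) := by
  funext v
  exact congrFun hr ⟨v.1, h' v.2.1, v.2.2⟩

theorem finsum_eq_sum_starSimplices {s : Finset ℕ} {n : ℕ} [Finite (Simplices K n)]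
    [Fintype (StarSimplices K s n)] (f : Simplices K n → F) (hf : ∀ w, ¬s ⊆ w.1 → f w = 0) :
    ∑ᶠ w, f w = ∑ w : StarSimplices K s n, f w.1 := by
  classical
  have := Fintype.ofFinite (Simplices K n)
  rw [finsum_eq_sum_of_fintype,
    ← Finset.sum_filter_of_ne (p := fun w => s ⊆ w.1) fun w _ h => by
      by_contra h'; exact h (hf w h')]
  exact Finset.sum_subtype _ (fun w => by simp) f

end Value

/-! ### The orientation condition with values in the field -/

section Orientation

variable {F : Type*} [Field F] {K : PreAbstractSimplicialComplex ℕ}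

theorem intCast_units_mul_self (u : ℤˣ) : ((u : ℤ) : F) * ((u : ℤ) : F) = 1 := by
  rcases Int.units_eq_one_or u with rfl | rfl <;> simp

/-- In characteristic 2 no orientation is needed: `v` has exactly two cofaces, and each contributes
`±1 = 1`. Otherwise the integral cycle condition is mapped to `F`; all cofaces of `v` contain `s`.
-/
theorem sum_orientation_mul_inc (p : ℕ) [CharP F p] (hK : IsClosedPLManifold 5 K)
    (o : Simplices K 5 → ℤˣ) (ho : p ≠ 2 → IsOrientation o) {s : Finset ℕ}
    [∀ n, Fintype (StarSimplices K s n)] (v : StarSimplices K s 4) :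
    ∑ w : StarSimplices K s 5, ((o w.1 : ℤ) : F) * inc F w.1.1 v.1.1 = 0 := by
  have hnot : ∀ w : Finset ℕ, ¬s ⊆ w → inc F w v.1.1 = 0 := fun w hw =>
    inc_eq_zero_of_not_subset fun h => hw (v.2.trans h)
  have := finite_simplices hK.finite 5
  by_cases hp : p = 2
  · subst hp
    obtain ⟨x, y, hxy, hL⟩ := hK.isTwoPoints_link v.1.2.1 v.1.2.2
    have hface : ∀ z, {z} ∈ (link K v.1.1).faces → ∃ w : StarSimplices K s 5,
        w.1.1 = insert z v.1.1 ∧ z ∉ v.1.1 := by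
      rintro z ⟨-, hd, hz⟩
      have hzv : z ∉ v.1.1 := Finset.disjoint_singleton_left.mp hd
      exact ⟨⟨⟨insert z v.1.1, hz, by rw [Finset.card_insert_of_notMem hzv, v.1.2.2]⟩,
        v.2.trans (Finset.subset_insert _ _)⟩, rfl, hzv⟩
    obtain ⟨w, hw, hxv⟩ := hface x ((hL _).mpr (Or.inl rfl))
    obtain ⟨w', hw', hyv⟩ := hface y ((hL _).mpr (Or.inr rfl))
    have hne : w.1.1 ≠ w'.1.1 := by
      rw [hw, hw']
      intro h
      have h1 : x ∈ insert y v.1.1 := h ▸ Finset.mem_insert_self x _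
      exact (Finset.mem_insert.mp h1).elim hxy hxv
    have hvw : v.1.1 ⊆ w.1.1 := hw ▸ Finset.subset_insert _ _
    have hvw' : v.1.1 ⊆ w'.1.1 := hw' ▸ Finset.subset_insert _ _
    rw [Fintype.sum_eq_add w w' (fun h => hne (by rw [h])) (fun u hu => by
      rw [inc_eq_zero_of_not_subset, mul_zero]
      intro h
      rcases exists_two_cofaces hK v.1 w.1.2.1 w'.1.2.1 w.1.2.2 w'.1.2.2 hvw hvw' hne u.1.1
        u.1.2.1 u.1.2.2 h with e | e
      · exact hu.1 (Subtype.ext (Subtype.ext e))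
      · exact hu.2 (Subtype.ext (Subtype.ext e)))]
    have hone : ∀ (u : StarSimplices K s 5) (z : ℕ), u.1.1 = insert z v.1.1 → z ∉ v.1.1 →
        ((o u.1 : ℤ) : F) * inc F u.1.1 v.1.1 = 1 := by
      intro u z hu hz
      have e : v.1.1 = u.1.1.erase z := by rw [hu, Finset.erase_insert hz]
      rw [e, inc_erase (by rw [hu]; exact Finset.mem_insert_self _ _)]
      rcases Int.units_eq_one_or (o u.1) with h | h <;>
        rcases sign_eq_one_or u.1.1 z with h' | h' <;> simp [h, h', CharTwo.neg_eq]
    rw [hone w x hw hxv, hone w' y hw' hyv, CharTwo.add_self_eq_zero]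
  · have h := congrArg (Int.cast : ℤ → F) (ho hp v.1)
    have := Fintype.ofFinite (Simplices K 5)
    rw [finsum_eq_sum_of_fintype, Int.cast_sum, Int.cast_zero] at h
    rw [← finsum_eq_sum_starSimplices (fun w => ((o w : ℤ) : F) * inc F w.1 v.1.1)
      (fun w hw => by rw [hnot _ hw, mul_zero]), finsum_eq_sum_of_fintype, ← h]
    exact Finset.sum_congr rfl fun w _ => by rw [Int.cast_mul, intCast_incidence]

end Orientation

/-! ### Invariance of the sum -/

section Invariance

variable {F : Type*} [Field F] {K : PreAbstractSimplicialComplex ℕ}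

theorem cochainSum_eq (o : Simplices K 5 → ℤˣ) (c : FiveCochain F) {ω : Param K F}
    (ρ σ : Permitted ω) :
    cochainSum o c ρ σ = ∑ᶠ w, ((o w : ℤ) : F) * c.value ρ σ w := rfl

theorem toPermitted_add (ω : Param K F) (ν ν' : Cocycles K 3 F) :
    toPermitted ω (ν + ν') = toPermitted ω ν + toPermitted ω ν' :=
  Subtype.ext (map_add (coloringOf ω) ν ν')

/-- The coloring of a cocycle vanishes on subcomplexes where the cocycle vanishes. -/
theorem restrictPermitted_toPermitted_add {L : PreAbstractSimplicialComplex ℕ} (h : L ≤ K)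
    {ω : Param K F} (r : Permitted ω) (ζ : Cocycles K 3 F) (hζ : restrict 3 F h ζ = 0) :
    restrictPermitted (r + toPermitted ω ζ) h = restrictPermitted r h := by
  refine Subtype.ext (funext fun v => ?_)
  change r.1 ⟨v.1, _⟩ + Submodule.Quotient.mk _ = r.1 ⟨v.1, _⟩
  refine (congrArg (r.1 ⟨v.1, h v.2.1, v.2.2⟩ + ·) ?_).trans (add_zero _)
  refine (Submodule.Quotient.mk_eq_zero _).mpr ?_
  have : restrict 3 F (simplex_le (h v.2.1)) ζ = 0 :=
    Subtype.ext (funext fun t => congrArg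
      (fun z => z.1 ⟨t.1, simplex_le v.2.1 t.2.1, t.2.2⟩) hζ)
  rw [this]
  exact Submodule.zero_mem _

theorem restrictPermitted_add_toPermitted {L : PreAbstractSimplicialComplex ℕ} (h : L ≤ K)
    {ω : Param K F} {r : Permitted ω} (ζ : Cocycles K 3 F) {μ : Cocycles L 3 F}
    (hr : (restrictPermitted r h).1 = coloringOf (ω.restrict h) μ) :
    (restrictPermitted (r + toPermitted ω ζ) h).1 =
      coloringOf (ω.restrict h) (μ + restrict 3 F h ζ) := by
  rw [map_add, ← hr]
  rfl

theorem restrict_coboundaryCocycle_eq_zero {L : PreAbstractSimplicialComplex ℕ} (h : L ≤ K)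
    {s : Finset ℕ} (hs : ¬s ∈ L.faces) {β : Cochain K 2 F} (hβ : ∀ t, t.1 ≠ s → β t = 0) :
    restrict 3 F h (coboundaryCocycle β) = 0 := by
  refine Subtype.ext (funext fun t => ?_)
  refine Finset.sum_eq_zero fun i _ => ?_
  rw [hβ, mul_zero]
  rintro rfl
  exact hs (erase_mem_face t i.2).1

theorem sign_insert_of_lt {w : Finset ℕ} {x : ℕ} (hx : ∀ i ∈ w, i < x) {i : ℕ} (hi : i ∈ w) :
    sign (insert x w) i = sign w i := by
  rw [sign_insert (fun h => (hx x h).false), if_neg (hx i hi).not_gt, one_mul]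

theorem sign_insert_self_of_lt {w : Finset ℕ} {x : ℕ} (hx : ∀ i ∈ w, i < x) :
    sign (insert x w) x = (-1) ^ w.card := by
  rw [sign_insert (fun h => (hx x h).false), if_neg (lt_irrefl x), one_mul, sign,
    Finset.filter_true_of_mem hx]

theorem diff_insert_of_lt {w : Finset ℕ} {x : ℕ} (hx : ∀ i ∈ w, i < x) (f : Finset ℕ → F) :
    diff f (insert x w) = (-1) ^ w.card * f w +
      ∑ i ∈ w, (sign w i : F) * f (insert x (w.erase i)) := by
  have hxw : x ∉ w := fun h => (hx x h).false
  rw [diff, Finset.sum_insert hxw, sign_insert_self_of_lt hx, Finset.erase_insert hxw]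
  congr 1
  · push_cast; rfl
  · refine Finset.sum_congr rfl fun i hi => ?_
    rw [sign_insert_of_lt hx hi, Finset.erase_insert_of_ne (hx i hi).ne']

/-- This is the core of the argument: the change of the sum is computed on the cone over the star of
the triangle. -/
theorem cochainSum_add_coboundary_single [Infinite F] (p : ℕ) [CharP F p]
    (hK : IsClosedPLManifold 5 K) (o : Simplices K 5 → ℤˣ) (ho : p ≠ 2 → IsOrientation o)
    {c : FiveCochain F} (hc : c.IsCocycle) {ω : Param K F} (ρ σ : Permitted ω)
    (s : Simplices K 2) {β : Cochain K 2 F} (hβ : ∀ t, t ≠ s → β t = 0) :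
    cochainSum o c (ρ + toPermitted ω (coboundaryCocycle β)) σ = cochainSum o c ρ σ := by
  classical
  have hfin := fun n => finite_simplices hK.finite n
  have hft : ∀ n, Fintype (StarSimplices K s.1 n) := fun n => Fintype.ofFinite _
  have hsne : s.1.Nonempty := face_nonempty s.2.1
  have ho' := fun v => sum_orientation_mul_inc (F := F) p hK o ho (s := s.1) v
  -- The apex comes last in the order, so the facets of `x * w` through `x` have the signs of the
  -- facets of `w`, and the facet `w` has sign `(-1)^6 = 1`.
  obtain ⟨x, hx⟩ : ∃ x : ℕ, ∀ t ∈ K.faces, ∀ i ∈ t, i < x := by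
    obtain ⟨x, hx⟩ := (hK.finite.biUnion fun t _ => t.finite_toSet).bddAbove
    exact ⟨x + 1, fun t ht i hi => Nat.lt_succ_of_le (hx (Set.mem_biUnion ht hi))⟩
  have hxK : ∀ t ∈ K.faces, x ∉ t := fun t ht h => (hx t ht x h).false
  obtain ⟨ν, hν⟩ := exists_cocycle_on_star hK s.2.1 s.2.2 (fun w => ((o w : ℤ) : F))
    (fun w => intCast_units_mul_self _) ho' ρ
  obtain ⟨η, hη⟩ := exists_cocycle_on_star hK s.2.1 s.2.2 (fun w => ((o w : ℤ) : F))
    (fun w => intCast_units_mul_self _) ho' σ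
  obtain ⟨ν', hν'⟩ := exists_cocycle_extension hsne x ν
  obtain ⟨η', hη'⟩ := exists_cocycle_extension hsne x η
  obtain ⟨ω', hω'⟩ := exists_param_extension hK.finite hsne hxK
    (ω.restrict (starComplex_le K s.1))
  set β' : Cochain (coneComplex K s.1 x) 2 F := fun t => if t.1 = s.1 then β s else 0 with hβ'
  set R₀ := toPermitted ω' ν' with hR₀
  set R₁ := R₀ + toPermitted ω' (coboundaryCocycle β') with hR₁
  set T := toPermitted ω' η' with hT
  -- The change of the value: a difference of two cocycles on the whole cone, zero on simplices
  -- without `s`.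
  set f : Cochain (coneComplex K s.1 x) 5 F := c.value R₁ T - c.value R₀ T with hf
  have hfc : coboundary _ 5 F f = 0 := by
    rw [hf, map_sub, hc.coboundary_value, hc.coboundary_value, sub_self]
  have hstar : ∀ w : StarSimplices K s.1 5, w.1.1 ∈ (starComplex K s.1).faces := fun w =>
    ⟨face_nonempty w.1.2.1, w.1.1, w.1.2.1, w.1.2.2, w.2, subset_rfl⟩
  have hcone : ∀ w : StarSimplices K s.1 5, w.1.1 ∈ (coneComplex K s.1 x).faces := fun w =>
    starComplex_le_coneComplex K s.1 x (hstar w)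
  have hβres : ∀ w : StarSimplices K s.1 5,
      restrict 3 F (simplex_le (hcone w)) (coboundaryCocycle β') =
        restrict 3 F (simplex_le w.1.2.1) (coboundaryCocycle β) := by
    intro w
    refine Subtype.ext (funext fun t => ?_)
    refine Finset.sum_congr rfl fun i _ => congrArg _ ?_
    rw [hβ']
    dsimp only
    split_ifs with h
    · exact congrArg β (Subtype.ext h.symm)
    · exact (hβ _ fun e => h (congrArg Subtype.val e)).symm
  have hωw : ∀ w : StarSimplices K s.1 5,
      ω.restrict (simplex_le w.1.2.1) = ω'.restrict (simplex_le (hcone w)) := fun w =>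
    (congrArg (fun z : Param (starComplex K s.1) F => z.restrict (simplex_le (hstar w))) hω').symm
  have hνw : ∀ w : StarSimplices K s.1 5, restrict 3 F (simplex_le (hcone w)) ν' =
      restrict 3 F (simplex_le (hstar w)) ν := fun w =>
    congrArg (fun z => restrict 3 F (simplex_le (hstar w)) z) hν'
  have hηw : ∀ w : StarSimplices K s.1 5, restrict 3 F (simplex_le (hcone w)) η' =
      restrict 3 F (simplex_le (hstar w)) η := fun w =>
    congrArg (fun z => restrict 3 F (simplex_le (hstar w)) z) hη'
  have hρ : ∀ w : StarSimplices K s.1 5, (restrictPermitted ρ (simplex_le w.1.2.1)).1 =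
      coloringOf (ω.restrict (simplex_le w.1.2.1)) (restrict 3 F (simplex_le (hcone w)) ν') := by
    intro w
    rw [hνw]
    exact restrict_eq_coloringOf (starComplex_le K s.1) (simplex_le (hstar w)) hν
  have hσ : ∀ w : StarSimplices K s.1 5, (restrictPermitted σ (simplex_le w.1.2.1)).1 =
      coloringOf (ω.restrict (simplex_le w.1.2.1)) (restrict 3 F (simplex_le (hcone w)) η') := by
    intro w
    rw [hηw]
    exact restrict_eq_coloringOf (starComplex_le K s.1) (simplex_le (hstar w)) hη
  have hval₀ : ∀ w : StarSimplices K s.1 5,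
      c.value ρ σ w.1 = c.value R₀ T ⟨w.1.1, hcone w, w.1.2.2⟩ := fun w =>
    c.congr w.1.2.2 (hωw w) _ _ (hρ w) rfl (hσ w) rfl
  have hval₁ : ∀ w : StarSimplices K s.1 5,
      c.value (ρ + toPermitted ω (coboundaryCocycle β)) σ w.1 =
        c.value R₁ T ⟨w.1.1, hcone w, w.1.2.2⟩ := by
    intro w
    have h₁ := restrictPermitted_add_toPermitted (simplex_le w.1.2.1) (coboundaryCocycle β) (hρ w)
    have h₂ := restrictPermitted_add_toPermitted (r := R₀) (simplex_le (hcone w))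
      (coboundaryCocycle β') (μ := restrict 3 F (simplex_le (hcone w)) ν') rfl
    rw [hβres w] at h₂
    exact c.congr w.1.2.2 (hωw w) _ _ h₁ h₂ (hσ w) rfl
  have hnot : ∀ w : Simplices K 5, ¬s.1 ⊆ w.1 →
      c.value (ρ + toPermitted ω (coboundaryCocycle β)) σ w = c.value ρ σ w := by
    intro w hw
    rw [FiveCochain.value, FiveCochain.value, restrictPermitted_toPermitted_add]
    exact restrict_coboundaryCocycle_eq_zero _ (s := s.1) (L := simplex w.1) (fun h => hw h.2)
      fun t ht => hβ t fun e => ht (congrArg Subtype.val e)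
  have hfnot : ∀ y : Simplices (coneComplex K s.1 x) 5, ¬s.1 ⊆ y.1 → f y = 0 := by
    intro y hy
    rw [hf, Pi.sub_apply, sub_eq_zero, FiveCochain.value, FiveCochain.value, hR₁,
      restrictPermitted_toPermitted_add]
    exact restrict_coboundaryCocycle_eq_zero _ (s := s.1) (L := simplex y.1) (fun h => hy h.2)
      fun t ht => if_neg ht
  -- This is `δf = 0` on `x * w`; the facets opposite vertices of `s` drop out because they do not
  -- contain `s`.
  have hfw : ∀ w : StarSimplices K s.1 5, zeroExt f w.1.1 =
      -∑ v : StarSimplices K s.1 4, inc F w.1.1 v.1.1 * zeroExt f (insert x v.1.1) := by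
    intro w
    have hxw := hx w.1.1 w.1.2.1
    have h1 : diff (zeroExt f) (insert x w.1.1) = 0 := by
      have := congrFun hfc ⟨insert x w.1.1, ⟨Finset.insert_nonempty _ _, w.1.1, w.1.2.1, w.1.2.2,
        w.2, subset_rfl⟩, by
          rw [Finset.card_insert_of_notMem (hxK _ w.1.2.1), w.1.2.2]⟩
      rwa [coboundary_eq_diff_zeroExt] at this
    rw [diff_insert_of_lt hxw, w.1.2.2,
      ← Finset.sum_subset (Finset.sdiff_subset : w.1.1 \ s.1 ⊆ w.1.1)] at h1
    · rw [sum_inc_mul w fun v => zeroExt f (insert x v)]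
      refine eq_neg_of_add_eq_zero_left ?_
      rw [← h1]
      norm_num
    · intro i hi his
      have his' : i ∈ s.1 := by
        by_contra h; exact his (Finset.mem_sdiff.mpr ⟨hi, h⟩)
      rw [zeroExt]
      split_ifs with h
      · rw [hfnot, mul_zero]
        intro hsub
        rcases Finset.mem_insert.mp (hsub his') with e | e
        · exact (hxw i hi).ne e
        · exact Finset.notMem_erase i _ e
      · rw [mul_zero]
  -- After interchanging the sums, `f(x * v)` is multiplied by the boundary of the oriented sum of
  -- 5-simplices at `v`, which is zero.
  have hsum : ∑ w : StarSimplices K s.1 5, ((o w.1 : ℤ) : F) * zeroExt f w.1.1 = 0 := by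
    have h1 : ∀ w : StarSimplices K s.1 5, ((o w.1 : ℤ) : F) * zeroExt f w.1.1 =
        ∑ v : StarSimplices K s.1 4,
          -zeroExt f (insert x v.1.1) * (((o w.1 : ℤ) : F) * inc F w.1.1 v.1.1) := by
      intro w
      rw [hfw w, mul_neg, Finset.mul_sum, ← Finset.sum_neg_distrib]
      exact Finset.sum_congr rfl fun v _ => by ring
    rw [Finset.sum_congr rfl fun w _ => h1 w, Finset.sum_comm]
    refine Finset.sum_eq_zero fun v _ => ?_
    rw [← Finset.mul_sum, ho' v, mul_zero]
  rw [← sub_eq_zero, cochainSum_eq, cochainSum_eq,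
    ← finsum_sub_distrib (Set.toFinite _) (Set.toFinite _),
    finsum_eq_sum_starSimplices (s := s.1) _ fun w hw => by rw [hnot w hw, sub_self]]
  refine Eq.trans ?_ hsum
  refine Finset.sum_congr rfl fun w _ => ?_
  rw [hval₀, hval₁, ← mul_sub]
  exact congrArg _ (zeroExt_apply f ⟨w.1.1, hcone w, w.1.2.2⟩).symm

/-- A cochain `β` is a finite sum of cochains supported on single triangles. The one-triangle case
holds for every permitted `ρ`, so the summands can be added one at a time. -/
theorem cochainSum_add_left [Infinite F] (p : ℕ) [CharP F p]
    (hK : IsClosedPLManifold 5 K) (o : Simplices K 5 → ℤˣ) (ho : p ≠ 2 → IsOrientation o)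
    {c : FiveCochain F} (hc : c.IsCocycle) {ω : Param K F} (ρ σ : Permitted ω) {g : Permitted ω}
    (hg : g ∈ gColorings ω) : cochainSum o c (ρ + g) σ = cochainSum o c ρ σ := by
  classical
  obtain ⟨ζ, ⟨β, hβ⟩, hζ⟩ := hg
  have hgβ : g = toPermitted ω (coboundaryCocycle β) :=
    Subtype.ext (hζ.symm.trans (congrArg (coloringOf ω) (Subtype.ext hβ.symm)))
  have := finite_simplices hK.finite 2
  have := Fintype.ofFinite (Simplices K 2)
  have hadd : ∀ β₁ β₂ : Cochain K 2 F, toPermitted ω (coboundaryCocycle (β₁ + β₂)) =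
      toPermitted ω (coboundaryCocycle β₁) + toPermitted ω (coboundaryCocycle β₂) := by
    intro β₁ β₂
    rw [← toPermitted_add]
    exact congrArg _ (Subtype.ext (map_add (coboundary K 2 F) β₁ β₂))
  have key : ∀ (β : Cochain K 2 F) (ρ : Permitted ω),
      cochainSum o c (ρ + toPermitted ω (coboundaryCocycle β)) σ = cochainSum o c ρ σ := by
    intro β
    rw [← Finset.univ_sum_single β]
    refine Finset.sum_induction _ (fun β => ∀ ρ : Permitted ω,
      cochainSum o c (ρ + toPermitted ω (coboundaryCocycle β)) σ = cochainSum o c ρ σ) ?_ ?_ ?_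
    · intro β₁ β₂ h₁ h₂ ρ
      rw [hadd, ← add_assoc, h₂, h₁]
    · intro ρ
      have h0 : toPermitted ω (coboundaryCocycle 0) = 0 :=
        Subtype.ext ((congrArg (coloringOf ω) (Subtype.ext (map_zero (coboundary K 2 F)))).trans
          (map_zero (coloringOf ω)))
      rw [h0, add_zero]
    · intro s _ ρ
      exact cochainSum_add_coboundary_single p hK o ho hc ρ σ s
        fun t ht => Pi.single_eq_of_ne ht _
  rw [hgβ]
  exact key β ρ

/-- The 5-cochain with the two colorings interchanged. -/
def FiveCochain.swap (c : FiveCochain F) : FiveCochain F := fun w hw ω r₁ r₂ => c w hw ω r₂ r₁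

theorem FiveCochain.IsCocycle.swap {c : FiveCochain F} (hc : c.IsCocycle) : c.swap.IsCocycle :=
  fun u hu ω r₁ r₂ => hc u hu ω r₂ r₁

theorem cochainSum_add_right [Infinite F] (p : ℕ) [CharP F p]
    (hK : IsClosedPLManifold 5 K) (o : Simplices K 5 → ℤˣ) (ho : p ≠ 2 → IsOrientation o)
    {c : FiveCochain F} (hc : c.IsCocycle) {ω : Param K F} (ρ σ : Permitted ω) {h : Permitted ω}
    (hh : h ∈ gColorings ω) : cochainSum o c ρ (σ + h) = cochainSum o c ρ σ :=
  cochainSum_add_left p hK o ho hc.swap σ ρ hh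

end Invariance

end Heptagon

end

/-! ### The proposition -/

theorem propositionp (p : ℕ) [Fact p.Prime] (F : Type*) [Field F] [CharP F p] [Infinite F]
    (K : PreAbstractSimplicialComplex ℕ) (hK : Heptagon.IsClosedPLManifold 5 K)
    (o : Heptagon.Simplices K 5 → ℤˣ) (ho : p ≠ 2 → Heptagon.IsOrientation o)
    (ω : Heptagon.Param K F) (c : Heptagon.FiveCochain F)
    (hc : (∃ k : ℕ, c = Heptagon.bipolynomialCocycle p k F) ∨ c.IsCocycle)
    (ρ σ : Heptagon.Permitted ω) (g h : Heptagon.Permitted ω)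
    (hg : g ∈ Heptagon.gColorings ω) (hh : h ∈ Heptagon.gColorings ω) :
    Heptagon.cochainSum o c (ρ + g) σ = Heptagon.cochainSum o c ρ σ ∧
      Heptagon.cochainSum o c ρ (σ + h) = Heptagon.cochainSum o c ρ σ ∧
      Heptagon.cochainSum o c (ρ + g) (σ + h) = Heptagon.cochainSum o c ρ σ := by
  have hcc : c.IsCocycle := by
    rcases hc with ⟨k, rfl⟩ | hc
    · exact Heptagon.isCocycle_bipolynomialCocycle p k
    · exact hc
  refine ⟨Heptagon.cochainSum_add_left p hK o ho hcc ρ σ hg,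
    Heptagon.cochainSum_add_right p hK o ho hcc ρ σ hh, ?_⟩
  rw [Heptagon.cochainSum_add_left p hK o ho hcc ρ (σ + h) hg,
    Heptagon.cochainSum_add_right p hK o ho hcc ρ σ hh]
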